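/- **Strong normalization of the history-aware calculus $\lambda^{hc}$.** *Syntax.* Fix a set of atomic types $P$, simple variables $a,b,\dots$ and audited variables $u,v,\dots$. Expressions are taken up to renaming of bound variables. Types, codes, terms and trails are given by $$A,B ::= P \mid A\supset B\mid [\![s]\!]A,\qquad s,t ::= a\mid u\mid \lambda a^A.s\mid s\,t\mid\ !s\mid \mathsf{let}(u^A:=s,t)\mid \mathsf{ti}(\theta),$$ $$M,N ::= a\mid u\mid \lambda a^A.M\mid M\,N\mid\ !_qM\mid \mathsf{let}(u^A:=M,N)\mid \mathsf{ti}(\vartheta),$$ $$q ::= \mathbf r(s)\mid \mathbf t(q,q')\mid \boldsymbol\beta(a^A.s,t)\mid \boldsymbol\beta_\Box(s,u^A.t)\mid \mathbf{ti}(q,\theta)\mid \mathbf{lam}(a^A.q)\mid \mathbf{app}(q,q')\mid \mathbf{let}(q,u^A.q')\mid \mathbf{trpl}(\zeta),$$ where $\theta,\vartheta,\zeta$ are finite partial maps, written as lists of distinct labels with their values, from the labels $\mathbf r,\mathbf t,\boldsymbol\beta,\boldsymbol\beta_\Box,\mathbf{ti},\mathbf{lam},\mathbf{app},\mathbf{let},\mathbf{trpl}_{[]},\mathbf{trpl}_{::},\mathbf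 d$ to codes, terms, trails respectively. *Auxiliary operations.* $q\theta$ is defined by recursion on $q$: if the label of the outermost constructor of $q$ is not in $\mathrm{dom}(\theta)$ the result is $\theta(\mathbf d)$; otherwise it is the branch of that label for $\mathbf r,\boldsymbol\beta,\boldsymbol\beta_\Box,\mathbf{ti}$, and that branch applied to the results on the immediate subtrails for $\mathbf t,\mathbf{lam},\mathbf{app},\mathbf{let}$; $\mathbf{trpl}(\{\})$ uses the label $\mathbf{trpl}_{[]}$, with result $\theta(\mathbf{trpl}_{[]})$, and $\mathbf{trpl}(\{q/\psi,\zeta\})$ uses $\mathbf{trpl}_{::}$, with result $\theta(\mathbf{trpl}_{::})\,(q\theta)\,(\mathbf{trpl}(\zeta)\theta)$. The term $q\vartheta$ is defined in the same way. The source $\mathrm{src}(q)$ is $\mathrm{src}(\mathbf r(s))=s$, $\mathrm{src}(\mathbf t(q,q'))=\mathrm{src}(q)$, $\mathrm{src}(\boldsymbol\beta(a^A.s,t))=(\lambda a^A.s)\,t$, $\mathrm{src}(\boldsymbol\beta_\Box(s,u^A.t))=\mathsf{let}(u^A:=\,!s,t)$, $\mathrm{src}(\mathbf{ti}(q,\theta))=\mathsf{ti}(\theta)$,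 and is homomorphic on $\mathbf{lam},\mathbf{app},\mathbf{let},\mathbf{trpl}$. The code $\mathrm{cd}(M)$ replaces each outermost $!_qN$ in $M$ by $!\,\mathrm{src}(q)$. Substitution $[t/a]$, $[N/a]$ for simple variables is capture-avoiding and leaves boxes $!s$, $!_qM$ unchanged; $[t/u]$ on codes, types and trails is the usual one. For $\delta=[(N,q,t)/u]$ and $\delta'=[t/u]$, the term $M\ltimes\delta$ and the trail $M\times\delta$ are: $u\ltimes\delta=N$, $u\times\delta=q$; for any other variable $x$, $x\ltimes\delta=x$ and $x\times\delta=\mathbf r(x)$; $(!_{q'}R)\ltimes\delta=\,!_{\mathbf t(q'\delta',\,R\times\delta)}(R\ltimes\delta)$ and $(!_{q'}R)\times\delta=\mathbf r(!(\mathrm{src}(q')\delta'))$; on $\lambda$, application, $\mathsf{let}$ and $\mathsf{ti}$, the operation $\ltimes$ is homomorphic, $\times$ produces $\mathbf{lam},\mathbf{app},\mathbf{let},\mathbf{trpl}$ respectively, and $\delta'$ is applied to the type annotations of binders. *Typing.* Let $\mathcal T^B(\psi)$ be $B\supset B$ for $\psi=\mathbf{lam}$, $B\supset B\supset B$ for $\psi\in\{\mathbf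 t,\mathbf{app},\mathbf{let},\mathbf{trpl}_{::}\}$, and $B$ for the other labels. Codes, $\Delta;\Gamma\vdash s:A$: - variables have the type declared for them ($a:A\in\Gamma$, $u::A\in\Delta$); - $\Delta;\Gamma,a{:}A\vdash s:B$ gives $\lambda a^A.s:A\supset B$; $s:A\supset B$ and $t:A$ give $s\,t:B$; - $\Delta;\cdot\vdash t:A$ gives $\Delta;\Gamma\vdash\,!t:[\![t]\!]A$; - $\Delta;\Gamma\vdash s:[\![r]\!]A$ and $\Delta,u{::}A;\Gamma\vdash t:C$ give $\mathsf{let}(u^A:=s,t):C[r/u]$; - $\mathbf d\in\mathrm{dom}(\theta)$ and $\Delta;\cdot\vdash\theta(\psi):\mathcal T^B(\psi)$ for all $\psi\in\mathrm{dom}(\theta)$ give $\Delta;\Gamma\vdash\mathsf{ti}(\theta):B$. Trails, $\Delta;\Gamma\vdash q:s\rhd_At$: - $s:A$ gives $\mathbf r(s):s\rhd_As$; $q:r\rhd_As$ and $q':s\rhd_At$ give $\mathbf t(q,q'):r\rhd_At$; - $\Delta;\Gamma,a{:}A\vdash s:B$ and $\Delta;\Gamma\vdash t:A$ give $\boldsymbol\beta(a^A.s,t):(\lambda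 a^A.s)\,t\rhd_Bs[t/a]$; - $\Delta;\cdot\vdash s:A$ and $\Delta,u{::}A;\Gamma\vdash t:C$ give $\boldsymbol\beta_\Box(s,u^A.t):\mathsf{let}(u^A:=\,!s,t)\rhd_{C[s/u]}t[s/u]$; - $\mathbf d\in\mathrm{dom}(\theta)$, $\Delta;\cdot\vdash q:s\rhd_At$ and $\Delta;\cdot\vdash\theta(\psi):\mathcal T^B(\psi)$ for all $\psi\in\mathrm{dom}(\theta)$ give $\mathbf{ti}(q,\theta):\mathsf{ti}(\theta)\rhd_Bq\theta$; - congruence: $\Delta;\Gamma,a{:}A\vdash q:s\rhd_Bt$ gives $\mathbf{lam}(a^A.q):\lambda a^A.s\rhd_{A\supset B}\lambda a^A.t$; $q:s\rhd_{A\supset B}t$ and $q':s'\rhd_At'$ give $\mathbf{app}(q,q'):s\,s'\rhd_Bt\,t'$; $q:s\rhd_{[\![r]\!]A}t$ and $\Delta,u{::}A;\Gamma\vdash q':s'\rhd_Ct'$ give $\mathbf{let}(q,u^A.q'):\mathsf{let}(u^A:=s,s')\rhd_{C[r/u]}\mathsf{let}(u^A:=t,t')$; if $\zeta,\theta,\theta'$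 have the same domain, containing $\mathbf d$, and $\Delta;\cdot\vdash\zeta(\psi):\theta(\psi)\rhd_{\mathcal T^B(\psi)}\theta'(\psi)$ for all $\psi$ in it, then $\mathbf{trpl}(\zeta):\mathsf{ti}(\theta)\rhd_B\mathsf{ti}(\theta')$. Terms, $\Delta;\Gamma\vdash M:A\mid s$: - variables have the type declared for them and themselves as code; abstraction and application are typed as for codes, with codes formed homomorphically; - $\Delta;\cdot\vdash M:A\mid t$ and $\Delta;\cdot\vdash q:s\rhd_At$ give $\Delta;\Gamma\vdash\,!_qM:[\![s]\!]A\mid\,!s$; - $\Delta;\Gamma\vdash M:[\![r]\!]A\mid s$ and $\Delta,u{::}A;\Gamma\vdash N:C\mid t$ give $\mathsf{let}(u^A:=M,N):C[r/u]\mid\mathsf{let}(u^A:=s,t)$; - if $\vartheta,\theta$ have the same domain, containing $\mathbf d$, and $\Delta;\cdot\vdash\vartheta(\psi):\mathcal T^B(\psi)\mid\theta(\psi)$ for all $\psi$ in it, then $\Delta;\Gamma\vdash\mathsf{ti}(\vartheta):B\mid\mathsf{ti}(\theta)$. *Reduction.* Let $\mathcal F$ range over term contexts with one hole that is not inside a box,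 and let $\mathcal Q_{\mathcal F}$ be the trail context obtained from $\mathcal F$ by replacing the constructors on the path to the hole by the corresponding $\mathbf{lam},\mathbf{app},\mathbf{let},\mathbf{trpl}$ and each side term $M$ by $\mathbf r(\mathrm{cd}(M))$. One-step reduction $\to$ is the least relation with - $!_q\mathcal F[(\lambda a^A.M)\,N]\to\,!_{\mathbf t(q,\mathcal Q_{\mathcal F}[\boldsymbol\beta(a^A.\mathrm{cd}(M),\mathrm{cd}(N))])}\mathcal F[M[N/a]]$; - $!_q\mathcal F[\mathsf{let}(u^A:=\,!_{q'}M,N)]\to\,!_{q_f}\mathcal F[N\ltimes\delta]$, where $\delta=[(M,q',\mathrm{src}(q'))/u]$ and $q_f=\mathbf t(q,\mathcal Q_{\mathcal F}[\mathbf t(\boldsymbol\beta_\Box(\mathrm{src}(q'),u^A.\mathrm{cd}(N)),N\times\delta)])$; - $!_q\mathcal F[\mathsf{ti}(\vartheta)]\to\,!_{\mathbf t(q,\mathcal Q_{\mathcal F}[\mathbf{ti}(q,\mathrm{cd}(\vartheta))])}\mathcal F[q\vartheta]$ (variables of $q$ not being captured by $\mathcal F$, and $q\vartheta$ being defined); -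 $!_q\mathcal F[M]\to\,!_q\mathcal F[N]$ whenever $M\to N$. A term is strongly normalizing if no infinite reduction sequence starts from it. **Claim.** If $\Delta;\Gamma\vdash M:A\mid s$, then $M$ is strongly normalizing; moreover, since reduction only acts inside a surrounding box, $!_qM$ is strongly normalizing for every trail $q$. -/

import Mathlib

/-!
The history-aware calculus. Variables are de Bruijn indices, so that expressions are taken up to
renaming of bound variables. There are two separate families of indices, one for simple variables
and one for audited variables. `P` is the set of atomic types.

The body of a box is typed without simple variables. Accordingly a box is opaque to simple
variables: renaming and substitution of simple variables do not enter boxes (nor types, whose codes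
are codes of boxed expressions). Audited variables are renamed and substituted everywhere, including
the type annotations of binders.
-/

namespace Lhc

universe u

/-- Labels of trail inspection branches. -/
inductive Label : Type
  | refl | trans | beta | betaBox | tinsp | lam | app | letb | otrNil | otrCons | dflt
  deriving DecidableEq

mutual
/-- Types: atoms, functions and audited units. -/
inductive Ty (P : Type u) : Type u
  | atom : P → Ty P
  | arr : Ty P → Ty P → Ty P
  | box : Code P → Ty P → Ty P

/-- Codes. In `lam A s` a simple variable is bound in `s`; in `letb A s t` an audited variable is
bound in `t`. -/
inductive Code (P : Type u) : Type u
  | svar : ℕ → Code P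
  | avar : ℕ → Code P
  | lam : Ty P → Code P → Code P
  | app : Code P → Code P → Code P
  | bang : Code P → Code P
  | letb : Ty P → Code P → Code P → Code P
  | ti : CodeBr P → Code P

/-- Inspection branches for codes, as a list of labelled codes. -/
inductive CodeBr (P : Type u) : Type u
  | nil : CodeBr P
  | cons : Label → Code P → CodeBr P → CodeBr P
end

mutual
/-- Trails. In `beta A s t` and `lam A q` a simple variable is bound in `s` and in `q`; in
`betaBox s A t` and `letb q A q'` an audited variable is bound in `t` and in `q'`. -/
inductive Trail (P : Type u) : Type u
  | refl : Code P → Trail P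
  | trans : Trail P → Trail P → Trail P
  | beta : Ty P → Code P → Code P → Trail P
  | betaBox : Code P → Ty P → Code P → Trail P
  | oti : Trail P → CodeBr P → Trail P
  | lam : Ty P → Trail P → Trail P
  | app : Trail P → Trail P → Trail P
  | letb : Trail P → Ty P → Trail P → Trail P
  | otr : TrailBr P → Trail P

/-- Inspection branches for trails. -/
inductive TrailBr (P : Type u) : Type u
  | nil : TrailBr P
  | cons : Label → Trail P → TrailBr P → TrailBr P
end

mutual
/-- Terms: like codes, but every box carries a trail. -/
inductive Term (P : Type u) : Type u
  | svar : ℕ → Term P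
  | avar : ℕ → Term P
  | lam : Ty P → Term P → Term P
  | app : Term P → Term P → Term P
  | bang : Trail P → Term P → Term P
  | letb : Ty P → Term P → Term P → Term P
  | ti : TermBr P → Term P

/-- Inspection branches for terms. -/
inductive TermBr (P : Type u) : Type u
  | nil : TermBr P
  | cons : Label → Term P → TermBr P → TermBr P
end

section Branches
variable {P : Type u}

/-- The domain of a family of branches, in the order in which the branches are listed. -/
def CodeBr.labels : CodeBr P → List Label
  | .nil => []
  | .cons ψ _ θ => ψ :: θ.labels

/-- The branch `θ(ψ)`, if `ψ` is in the domain. -/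
def CodeBr.get : CodeBr P → Label → Option (Code P)
  | .nil, _ => none
  | .cons ψ s θ, φ => if ψ = φ then some s else θ.get φ

def TrailBr.labels : TrailBr P → List Label
  | .nil => []
  | .cons ψ _ ζ => ψ :: ζ.labels

def TrailBr.append : TrailBr P → TrailBr P → TrailBr P
  | .nil, ζ' => ζ'
  | .cons ψ q ζ, ζ' => .cons ψ q (ζ.append ζ')

def TermBr.labels : TermBr P → List Label
  | .nil => []
  | .cons ψ _ θ => ψ :: θ.labels

def TermBr.get : TermBr P → Label → Option (Term P)
  | .nil, _ => none
  | .cons ψ M θ, φ => if ψ = φ then some M else θ.get φ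

def TermBr.append : TermBr P → TermBr P → TermBr P
  | .nil, θ' => θ'
  | .cons ψ M θ, θ' => .cons ψ M (θ.append θ')

end Branches

section Inspection
variable {P : Type u} {X : Type u}

mutual
/-- Trail inspection: structural recursion on a trail with branches `f` in a set `X` of expressions
(codes or terms) whose application is `ap`. A label outside the domain of `f` takes the default
branch; the result is undefined when a default branch is needed and missing. -/
def Trail.inspect (ap : X → X → X) (f : Label → Option X) : Trail P → Option X
  | .refl _ => (f .refl).or (f .dflt)
  | .trans q q' =>
    match f .trans with
    | none => f .dflt
    | some s => do
      let x ← q.inspect ap f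
      let y ← q'.inspect ap f
      return ap (ap s x) y
  | .beta _ _ _ => (f .beta).or (f .dflt)
  | .betaBox _ _ _ => (f .betaBox).or (f .dflt)
  | .oti _ _ => (f .tinsp).or (f .dflt)
  | .lam _ q =>
    match f .lam with
    | none => f .dflt
    | some s => do
      let x ← q.inspect ap f
      return ap s x
  | .app q q' =>
    match f .app with
    | none => f .dflt
    | some s => do
      let x ← q.inspect ap f
      let y ← q'.inspect ap f
      return ap (ap s x) y
  | .letb q _ q' =>
    match f .letb with
    | none => f .dflt
    | some s => do
      let x ← q.inspect ap f
      let y ← q'.inspect ap f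
      return ap (ap s x) y
  | .otr ζ => ζ.inspect ap f

/-- Inspection of a congruence `otr ζ`, by recursion on `ζ`. -/
def TrailBr.inspect (ap : X → X → X) (f : Label → Option X) : TrailBr P → Option X
  | .nil => (f .otrNil).or (f .dflt)
  | .cons _ q ζ =>
    match f .otrCons with
    | none => f .dflt
    | some s => do
      let x ← q.inspect ap f
      let y ← ζ.inspect ap f
      return ap (ap s x) y
end

/-- The code `qθ`. -/
def Trail.inspectCode (q : Trail P) (θ : CodeBr P) : Option (Code P) :=
  q.inspect Code.app θ.get

/-- The term `qϑ`. -/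
def Trail.inspectTerm (q : Trail P) (θ : TermBr P) : Option (Term P) :=
  q.inspect Term.app θ.get

end Inspection

/-- The extension of a renaming of indices under a binder. -/
def up (ξ : ℕ → ℕ) : ℕ → ℕ
  | 0 => 0
  | n + 1 => ξ n + 1

section Renaming
variable {P : Type u}

mutual
/-- Renaming of audited variables in types. -/
def Ty.ren (ρ : ℕ → ℕ) : Ty P → Ty P
  | .atom p => .atom p
  | .arr A B => .arr (A.ren ρ) (B.ren ρ)
  | .box s A => .box (s.ren id ρ) (A.ren ρ)

/-- Renaming of simple variables by `ξ` and of audited variables by `ρ`. -/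
def Code.ren (ξ ρ : ℕ → ℕ) : Code P → Code P
  | .svar i => .svar (ξ i)
  | .avar i => .avar (ρ i)
  | .lam A s => .lam (A.ren ρ) (s.ren (up ξ) ρ)
  | .app s t => .app (s.ren ξ ρ) (t.ren ξ ρ)
  | .bang s => .bang (s.ren id ρ)
  | .letb A s t => .letb (A.ren ρ) (s.ren ξ ρ) (t.ren ξ (up ρ))
  | .ti θ => .ti (θ.ren ξ ρ)

def CodeBr.ren (ξ ρ : ℕ → ℕ) : CodeBr P → CodeBr P
  | .nil => .nil
  | .cons ψ s θ => .cons ψ (s.ren ξ ρ) (θ.ren ξ ρ)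
end

mutual
def Trail.ren (ξ ρ : ℕ → ℕ) : Trail P → Trail P
  | .refl s => .refl (s.ren ξ ρ)
  | .trans q q' => .trans (q.ren ξ ρ) (q'.ren ξ ρ)
  | .beta A s t => .beta (A.ren ρ) (s.ren (up ξ) ρ) (t.ren ξ ρ)
  | .betaBox s A t => .betaBox (s.ren ξ ρ) (A.ren ρ) (t.ren ξ (up ρ))
  | .oti q θ => .oti (q.ren ξ ρ) (θ.ren ξ ρ)
  | .lam A q => .lam (A.ren ρ) (q.ren (up ξ) ρ)
  | .app q q' => .app (q.ren ξ ρ) (q'.ren ξ ρ)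
  | .letb q A q' => .letb (q.ren ξ ρ) (A.ren ρ) (q'.ren ξ (up ρ))
  | .otr ζ => .otr (ζ.ren ξ ρ)

def TrailBr.ren (ξ ρ : ℕ → ℕ) : TrailBr P → TrailBr P
  | .nil => .nil
  | .cons ψ q ζ => .cons ψ (q.ren ξ ρ) (ζ.ren ξ ρ)
end

mutual
def Term.ren (ξ ρ : ℕ → ℕ) : Term P → Term P
  | .svar i => .svar (ξ i)
  | .avar i => .avar (ρ i)
  | .lam A M => .lam (A.ren ρ) (M.ren (up ξ) ρ)
  | .app M N => .app (M.ren ξ ρ) (N.ren ξ ρ)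
  | .bang q M => .bang (q.ren id ρ) (M.ren id ρ)
  | .letb A M N => .letb (A.ren ρ) (M.ren ξ ρ) (N.ren ξ (up ρ))
  | .ti θ => .ti (θ.ren ξ ρ)

def TermBr.ren (ξ ρ : ℕ → ℕ) : TermBr P → TermBr P
  | .nil => .nil
  | .cons ψ M θ => .cons ψ (M.ren ξ ρ) (θ.ren ξ ρ)
end

end Renaming

section CodeSubstitution
variable {P : Type u}

/-- A substitution of codes for simple variables, moved under a simple binder. -/
def Code.supS (σ : ℕ → Code P) : ℕ → Code P
  | 0 => .svar 0
  | n + 1 => (σ n).ren Nat.succ id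

/-- A substitution of codes for audited variables, moved under an audited binder. -/
def Code.aupA (τ : ℕ → Code P) : ℕ → Code P
  | 0 => .avar 0
  | n + 1 => (τ n).ren id Nat.succ

mutual
/-- Substitution of simple variables in codes. -/
def Code.ssubst (σ : ℕ → Code P) : Code P → Code P
  | .svar i => σ i
  | .avar i => .avar i
  | .lam A s => .lam A (s.ssubst (Code.supS σ))
  | .app s t => .app (s.ssubst σ) (t.ssubst σ)
  | .bang s => .bang s
  | .letb A s t => .letb A (s.ssubst σ) (t.ssubst fun i => (σ i).ren id Nat.succ)
  | .ti θ => .ti (θ.ssubst σ)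

def CodeBr.ssubst (σ : ℕ → Code P) : CodeBr P → CodeBr P
  | .nil => .nil
  | .cons ψ s θ => .cons ψ (s.ssubst σ) (θ.ssubst σ)
end

mutual
/-- Substitution of audited variables in types. -/
def Ty.asubst (τ : ℕ → Code P) : Ty P → Ty P
  | .atom p => .atom p
  | .arr A B => .arr (A.asubst τ) (B.asubst τ)
  | .box s A => .box (s.asubst τ) (A.asubst τ)

/-- Substitution of audited variables in codes. -/
def Code.asubst (τ : ℕ → Code P) : Code P → Code P
  | .svar i => .svar i
  | .avar i => τ i
  | .lam A s => .lam (A.asubst τ) (s.asubst fun i => (τ i).ren Nat.succ id)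
  | .app s t => .app (s.asubst τ) (t.asubst τ)
  | .bang s => .bang (s.asubst τ)
  | .letb A s t => .letb (A.asubst τ) (s.asubst τ) (t.asubst (Code.aupA τ))
  | .ti θ => .ti (θ.asubst τ)

def CodeBr.asubst (τ : ℕ → Code P) : CodeBr P → CodeBr P
  | .nil => .nil
  | .cons ψ s θ => .cons ψ (s.asubst τ) (θ.asubst τ)
end

mutual
/-- Substitution of audited variables in trails. -/
def Trail.asubst (τ : ℕ → Code P) : Trail P → Trail P
  | .refl s => .refl (s.asubst τ)
  | .trans q q' => .trans (q.asubst τ) (q'.asubst τ)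
  | .beta A s t =>
    .beta (A.asubst τ) (s.asubst fun i => (τ i).ren Nat.succ id) (t.asubst τ)
  | .betaBox s A t => .betaBox (s.asubst τ) (A.asubst τ) (t.asubst (Code.aupA τ))
  | .oti q θ => .oti (q.asubst τ) (θ.asubst τ)
  | .lam A q => .lam (A.asubst τ) (q.asubst fun i => (τ i).ren Nat.succ id)
  | .app q q' => .app (q.asubst τ) (q'.asubst τ)
  | .letb q A q' => .letb (q.asubst τ) (A.asubst τ) (q'.asubst (Code.aupA τ))
  | .otr ζ => .otr (ζ.asubst τ)

def TrailBr.asubst (τ : ℕ → Code P) : TrailBr P → TrailBr P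
  | .nil => .nil
  | .cons ψ q ζ => .cons ψ (q.asubst τ) (ζ.asubst τ)
end

/-- `s[t/a]` where `a` is the simple variable with index `0`, whose binder is removed. -/
def Code.sinst (s t : Code P) : Code P :=
  s.ssubst fun
    | 0 => t
    | n + 1 => .svar n

/-- The substitution `[t/u]` where `u` is the audited variable with index `0`, whose binder is
removed. -/
def Code.single (t : Code P) : ℕ → Code P
  | 0 => t
  | n + 1 => .avar n

/-- `s[t/u]` for codes. -/
def Code.ainst (s t : Code P) : Code P := s.asubst t.single

/-- `A[t/u]` for types. -/
def Ty.ainst (A : Ty P) (t : Code P) : Ty P := A.asubst t.single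

end CodeSubstitution

section SourceAndCode
variable {P : Type u}

mutual
/-- The source of a trail. -/
def Trail.src : Trail P → Code P
  | .refl s => s
  | .trans q _ => q.src
  | .beta A s t => .app (.lam A s) t
  | .betaBox s A t => .letb A (.bang s) t
  | .oti _ θ => .ti θ
  | .lam A q => .lam A q.src
  | .app q q' => .app q.src q'.src
  | .letb q A q' => .letb A q.src q'.src
  | .otr ζ => .ti ζ.src

def TrailBr.src : TrailBr P → CodeBr P
  | .nil => .nil
  | .cons ψ q ζ => .cons ψ q.src ζ.src
end

mutual
/-- The code of a term. -/
def Term.code : Term P → Code P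
  | .svar i => .svar i
  | .avar i => .avar i
  | .lam A M => .lam A M.code
  | .app M N => .app M.code N.code
  | .bang q _ => .bang q.src
  | .letb A M N => .letb A M.code N.code
  | .ti θ => .ti θ.code

def TermBr.code : TermBr P → CodeBr P
  | .nil => .nil
  | .cons ψ M θ => .cons ψ M.code θ.code
end

/-- The trails `refl(code(M))`, branch by branch. -/
def TermBr.reflCode : TermBr P → TrailBr P
  | .nil => .nil
  | .cons ψ M θ => .cons ψ (.refl M.code) θ.reflCode

end SourceAndCode

section TermSubstitution
variable {P : Type u}

/-- A substitution of terms for simple variables, moved under a simple binder. -/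
def Term.supS (σ : ℕ → Term P) : ℕ → Term P
  | 0 => .svar 0
  | n + 1 => (σ n).ren Nat.succ id

mutual
/-- Substitution of simple variables in terms. -/
def Term.ssubst (σ : ℕ → Term P) : Term P → Term P
  | .svar i => σ i
  | .avar i => .avar i
  | .lam A M => .lam A (M.ssubst (Term.supS σ))
  | .app M N => .app (M.ssubst σ) (N.ssubst σ)
  | .bang q M => .bang q M
  | .letb A M N => .letb A (M.ssubst σ) (N.ssubst fun i => (σ i).ren id Nat.succ)
  | .ti θ => .ti (θ.ssubst σ)

def TermBr.ssubst (σ : ℕ → Term P) : TermBr P → TermBr P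
  | .nil => .nil
  | .cons ψ M θ => .cons ψ (M.ssubst σ) (θ.ssubst σ)
end

/-- `M[N/a]` where `a` is the simple variable with index `0`, whose binder is removed. -/
def Term.sinst (M N : Term P) : Term P :=
  M.ssubst fun
    | 0 => N
    | n + 1 => .svar n

/-- The data `(N, q, t)` substituted for an audited variable in terms. -/
structure Audit (P : Type u) : Type u where
  term : Term P
  trail : Trail P
  code : Code P

def Audit.ren (ξ ρ : ℕ → ℕ) (d : Audit P) : Audit P :=
  ⟨d.term.ren ξ ρ, d.trail.ren ξ ρ, d.code.ren ξ ρ⟩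

/-- The triple that leaves the audited variable `i` unchanged. -/
def Audit.var (i : ℕ) : Audit P := ⟨.avar i, .refl (.avar i), .avar i⟩

/-- An audited substitution moved under an audited binder. -/
def Audit.up (δ : ℕ → Audit P) : ℕ → Audit P
  | 0 => .var 0
  | n + 1 => (δ n).ren id Nat.succ

/-- The audited substitution `[(N, q, t)/u]` where `u` is the audited variable with index `0`, whose
binder is removed. -/
def Audit.single (d : Audit P) : ℕ → Audit P
  | 0 => d
  | n + 1 => .var n

mutual
/-- The trail `M × δ`. -/
def Term.atrail (δ : ℕ → Audit P) : Term P → Trail P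
  | .svar i => .refl (.svar i)
  | .avar i => (δ i).trail
  | .lam A M =>
    .lam (A.asubst fun i => (δ i).code) (M.atrail fun i => (δ i).ren Nat.succ id)
  | .app M N => .app (M.atrail δ) (N.atrail δ)
  | .bang q _ => .refl (.bang (q.src.asubst fun i => (δ i).code))
  | .letb A M N =>
    .letb (M.atrail δ) (A.asubst fun i => (δ i).code) (N.atrail (Audit.up δ))
  | .ti θ => .otr (θ.atrail δ)

def TermBr.atrail (δ : ℕ → Audit P) : TermBr P → TrailBr P
  | .nil => .nil
  | .cons ψ M θ => .cons ψ (M.atrail δ) (θ.atrail δ)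
end

mutual
/-- The term `M ⋉ δ`. -/
def Term.asubst (δ : ℕ → Audit P) : Term P → Term P
  | .svar i => .svar i
  | .avar i => (δ i).term
  | .lam A M =>
    .lam (A.asubst fun i => (δ i).code) (M.asubst fun i => (δ i).ren Nat.succ id)
  | .app M N => .app (M.asubst δ) (N.asubst δ)
  | .bang q M =>
    .bang (.trans (q.asubst fun i => (δ i).code) (M.atrail δ)) (M.asubst δ)
  | .letb A M N =>
    .letb (A.asubst fun i => (δ i).code) (M.asubst δ) (N.asubst (Audit.up δ))
  | .ti θ => .ti (θ.asubst δ)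

def TermBr.asubst (δ : ℕ → Audit P) : TermBr P → TermBr P
  | .nil => .nil
  | .cons ψ M θ => .cons ψ (M.asubst δ) (θ.asubst δ)
end

end TermSubstitution

section Typing
variable {P : Type u}

/-- The type of the branch labelled `ψ` in an inspection with result type `B`. -/
def branchTy (B : Ty P) : Label → Ty P
  | .lam => .arr B B
  | .trans | .app | .letb | .otrCons => .arr B (.arr B B)
  | .refl | .beta | .betaBox | .tinsp | .otrNil | .dflt => B

/-- Weakening of a context by a new audited variable. -/
def shiftCtx (Γ : List (Ty P)) : List (Ty P) := Γ.map (Ty.ren Nat.succ)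

/-- The context `Δ, u :: A`. All types of an audited context are types over the whole context. -/
def extA (A : Ty P) (Δ : List (Ty P)) : List (Ty P) := shiftCtx (A :: Δ)

mutual
/-- `Δ; Γ ⊢ s : A` for codes. -/
inductive CodeTy : List (Ty P) → List (Ty P) → Code P → Ty P → Prop
  | svar {Δ Γ i A} : Γ[i]? = some A → CodeTy Δ Γ (.svar i) A
  | avar {Δ Γ i A} : Δ[i]? = some A → CodeTy Δ Γ (.avar i) A
  | lam {Δ Γ A s B} : CodeTy Δ (A :: Γ) s B → CodeTy Δ Γ (.lam A s) (.arr A B)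
  | app {Δ Γ s t A B} : CodeTy Δ Γ s (.arr A B) → CodeTy Δ Γ t A → CodeTy Δ Γ (.app s t) B
  | bang {Δ Γ t A} : CodeTy Δ [] t A → CodeTy Δ Γ (.bang t) (.box t A)
  | letb {Δ Γ s t r A C} : CodeTy Δ Γ s (.box r A) → CodeTy (extA A Δ) (shiftCtx Γ) t C →
      CodeTy Δ Γ (.letb A s t) (C.ainst r)
  | ti {Δ Γ θ B} : θ.labels.Nodup → Label.dflt ∈ θ.labels → CodeBrTy Δ θ B →
      CodeTy Δ Γ (.ti θ) B

/-- Every branch `θ(ψ)` has the type `branchTy B ψ` without simple variables. -/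
inductive CodeBrTy : List (Ty P) → CodeBr P → Ty P → Prop
  | nil {Δ B} : CodeBrTy Δ .nil B
  | cons {Δ ψ s θ B} : CodeTy Δ [] s (branchTy B ψ) → CodeBrTy Δ θ B →
      CodeBrTy Δ (.cons ψ s θ) B
end

mutual
/-- `Δ; Γ ⊢ q : s ▷ t` at type `A`, for trails. -/
inductive TrailTy : List (Ty P) → List (Ty P) → Trail P → Code P → Code P → Ty P → Prop
  | refl {Δ Γ s A} : CodeTy Δ Γ s A → TrailTy Δ Γ (.refl s) s s A
  | trans {Δ Γ q q' r s t A} : TrailTy Δ Γ q r s A → TrailTy Δ Γ q' s t A →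
      TrailTy Δ Γ (.trans q q') r t A
  | beta {Δ Γ A s t B} : CodeTy Δ (A :: Γ) s B → CodeTy Δ Γ t A →
      TrailTy Δ Γ (.beta A s t) (.app (.lam A s) t) (s.sinst t) B
  | betaBox {Δ Γ s A t C} : CodeTy Δ [] s A → CodeTy (extA A Δ) (shiftCtx Γ) t C →
      TrailTy Δ Γ (.betaBox s A t) (.letb A (.bang s) t) (t.ainst s) (C.ainst s)
  | oti {Δ Γ q θ s t r A B} : θ.labels.Nodup → Label.dflt ∈ θ.labels → TrailTy Δ [] q s t A →
      CodeBrTy Δ θ B → q.inspectCode θ = some r → TrailTy Δ Γ (.oti q θ) (.ti θ) r B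
  | lam {Δ Γ A q s t B} : TrailTy Δ (A :: Γ) q s t B →
      TrailTy Δ Γ (.lam A q) (.lam A s) (.lam A t) (.arr A B)
  | app {Δ Γ q q' s t s' t' A B} : TrailTy Δ Γ q s t (.arr A B) → TrailTy Δ Γ q' s' t' A →
      TrailTy Δ Γ (.app q q') (.app s s') (.app t t') B
  | letb {Δ Γ q q' s t s' t' r A C} : TrailTy Δ Γ q s t (.box r A) →
      TrailTy (extA A Δ) (shiftCtx Γ) q' s' t' C →
      TrailTy Δ Γ (.letb q A q') (.letb A s s') (.letb A t t') (C.ainst r)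
  | otr {Δ Γ ζ θ θ' B} : ζ.labels.Nodup → Label.dflt ∈ ζ.labels → TrailBrTy Δ ζ θ θ' B →
      TrailTy Δ Γ (.otr ζ) (.ti θ) (.ti θ') B

/-- `ζ`, `θ` and `θ'` have the same labels, and each `ζ(ψ)` is a trail from `θ(ψ)` to `θ'(ψ)` at type
`branchTy B ψ` without simple variables. -/
inductive TrailBrTy : List (Ty P) → TrailBr P → CodeBr P → CodeBr P → Ty P → Prop
  | nil {Δ B} : TrailBrTy Δ .nil .nil .nil B
  | cons {Δ ψ q s t ζ θ θ' B} : TrailTy Δ [] q s t (branchTy B ψ) → TrailBrTy Δ ζ θ θ' B →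
      TrailBrTy Δ (.cons ψ q ζ) (.cons ψ s θ) (.cons ψ t θ') B
end

mutual
/-- `Δ; Γ ⊢ M : A | s` for terms. -/
inductive TermTy : List (Ty P) → List (Ty P) → Term P → Ty P → Code P → Prop
  | svar {Δ Γ i A} : Γ[i]? = some A → TermTy Δ Γ (.svar i) A (.svar i)
  | avar {Δ Γ i A} : Δ[i]? = some A → TermTy Δ Γ (.avar i) A (.avar i)
  | lam {Δ Γ A M B s} : TermTy Δ (A :: Γ) M B s → TermTy Δ Γ (.lam A M) (.arr A B) (.lam A s)
  | app {Δ Γ M N A B s t} : TermTy Δ Γ M (.arr A B) s → TermTy Δ Γ N A t →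
      TermTy Δ Γ (.app M N) B (.app s t)
  | bang {Δ Γ q M A s t} : TermTy Δ [] M A t → TrailTy Δ [] q s t A →
      TermTy Δ Γ (.bang q M) (.box s A) (.bang s)
  | letb {Δ Γ M N r A C s t} : TermTy Δ Γ M (.box r A) s →
      TermTy (extA A Δ) (shiftCtx Γ) N C t →
      TermTy Δ Γ (.letb A M N) (C.ainst r) (.letb A s t)
  | ti {Δ Γ ϑ θ B} : ϑ.labels.Nodup → Label.dflt ∈ ϑ.labels → TermBrTy Δ ϑ B θ →
      TermTy Δ Γ (.ti ϑ) B (.ti θ)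

/-- `ϑ` and `θ` have the same labels, and each `ϑ(ψ)` has type `branchTy B ψ` and code `θ(ψ)`
without simple variables. -/
inductive TermBrTy : List (Ty P) → TermBr P → Ty P → CodeBr P → Prop
  | nil {Δ B} : TermBrTy Δ .nil B .nil
  | cons {Δ ψ M s ϑ θ B} : TermTy Δ [] M (branchTy B ψ) s → TermBrTy Δ ϑ B θ →
      TermBrTy Δ (.cons ψ M ϑ) B (.cons ψ s θ)
end

end Typing

/-- Contexts with a hole that is not inside a box. -/
inductive FCtx (P : Type u) : Type u
  | hole : FCtx P
  | lam : Ty P → FCtx P → FCtx P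
  | appL : FCtx P → Term P → FCtx P
  | appR : Term P → FCtx P → FCtx P
  | letL : Ty P → FCtx P → Term P → FCtx P
  | letR : Ty P → Term P → FCtx P → FCtx P
  | ti : TermBr P → Label → FCtx P → TermBr P → FCtx P

section Reduction
variable {P : Type u}

/-- `F[M]`: the variables of `M` may be captured. -/
def FCtx.fill : FCtx P → Term P → Term P
  | .hole, M => M
  | .lam A F, M => .lam A (F.fill M)
  | .appL F N, M => .app (F.fill M) N
  | .appR N F, M => .app N (F.fill M)
  | .letL A F N, M => .letb A (F.fill M) N
  | .letR A N F, M => .letb A N (F.fill M)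
  | .ti ϑ ψ F ϑ', M => .ti (ϑ.append (.cons ψ (F.fill M) ϑ'))

/-- `Q_F[q]`, where `Q_F` is the canonical trail context of `F`. -/
def FCtx.fillTrail : FCtx P → Trail P → Trail P
  | .hole, q => q
  | .lam A F, q => .lam A (F.fillTrail q)
  | .appL F N, q => .app (F.fillTrail q) (.refl N.code)
  | .appR N F, q => .app (.refl N.code) (F.fillTrail q)
  | .letL A F N, q => .letb (F.fillTrail q) A (.refl N.code)
  | .letR A N F, q => .letb (.refl N.code) A (F.fillTrail q)
  | .ti ϑ ψ F ϑ', q => .otr (ϑ.reflCode.append (.cons ψ (F.fillTrail q) ϑ'.reflCode))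

/-- The number of simple binders above the hole. -/
def FCtx.sdepth : FCtx P → ℕ
  | .hole => 0
  | .lam _ F => F.sdepth + 1
  | .appL F _ => F.sdepth
  | .appR _ F => F.sdepth
  | .letL _ F _ => F.sdepth
  | .letR _ _ F => F.sdepth
  | .ti _ _ F _ => F.sdepth

/-- The number of audited binders above the hole. -/
def FCtx.adepth : FCtx P → ℕ
  | .hole => 0
  | .lam _ F => F.adepth
  | .appL F _ => F.adepth
  | .appR _ F => F.adepth
  | .letL _ F _ => F.adepth
  | .letR _ _ F => F.adepth + 1
  | .ti _ _ F _ => F.adepth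

/-- A trail moved from outside `F` to the hole of `F`, without capture of its variables. -/
def FCtx.weaken (F : FCtx P) (q : Trail P) : Trail P :=
  q.ren (· + F.sdepth) (· + F.adepth)

/-- One-step reduction of terms that are surrounded by a box. -/
inductive Red : Term P → Term P → Prop
  | beta (q : Trail P) (F : FCtx P) (A : Ty P) (M N : Term P) :
      Red (.bang q (F.fill (.app (.lam A M) N)))
        (.bang (.trans q (F.fillTrail (.beta A M.code N.code))) (F.fill (M.sinst N)))
  | betaBox (q : Trail P) (F : FCtx P) (A : Ty P) (q' : Trail P) (M N : Term P) :
      Red (.bang q (F.fill (.letb A (.bang q' M) N)))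
        (.bang
          (.trans q (F.fillTrail
            (.trans (.betaBox q'.src A N.code) (N.atrail (Audit.single ⟨M, q', q'.src⟩)))))
          (F.fill (N.asubst (Audit.single ⟨M, q', q'.src⟩))))
  | ti (q : Trail P) (F : FCtx P) (ϑ : TermBr P) (R : Term P) : q.inspectTerm ϑ = some R →
      Red (.bang q (F.fill (.ti ϑ)))
        (.bang (.trans q (F.fillTrail (.oti (F.weaken q) ϑ.code))) (F.fill R))
  | bang (q : Trail P) (F : FCtx P) (M N : Term P) : Red M N →
      Red (.bang q (F.fill M)) (.bang q (F.fill N))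

/-- Strong normalization: there is no infinite reduction sequence from `M`. -/
def SN (M : Term P) : Prop := Acc (fun N' N => Red N N') M

end Reduction

end Lhc

namespace Lhc

-- Terms are erased to skeletons: trails, codes and annotations disappear, a box becomes its body,
-- and `letb` becomes an ordinary beta redex. What trails can influence is only the outcome of an
-- inspection, so a skeleton `ti f` may reduce to the result of inspecting any trail whatsoever.
-- This overapproximation costs nothing in termination: every branch has the type dictated by its
-- label and the result type `B`, so whichever trail is inspected, the result is an applicative
-- combination of branches of type `B`.
--
-- Two facts give the theorem. By Tait and Girard's reducibility method the skeleton of a typed term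
-- is reducible (`TermTy.reducible`), hence strongly normalizing; the dependency of types on codes
-- plays no role, since reducibility at `box s A` is reducibility at `A`. Further, each reduction of
-- a box is one step of skeletons (`Red.exists_simulates`), so an infinite reduction of boxes would
-- yield one of skeletons.
--
-- The simulation does not need subject reduction. The only invariant is `Scoped`. Its absence of
-- outer simple variables in boxes is needed because `betaBox` moves a box body to places with other
-- simple variables; its distinctness of labels ensures that a reduction inside a branch is visible
-- in the skeleton.

theorem update_map {α β γ : Type*} [DecidableEq α] (g : β → γ) (f : α → β) (a : α) (b : β) :
    (fun x => g (Function.update f a b x)) = Function.update (fun x => g (f x)) a (g b) :=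
  Function.comp_update g f a b

-- Skeletons and their substitution calculus.

/-- Untyped lambda terms with a constant and inspection nodes. They are what remains of a term when
trails and type annotations are erased, boxes are opened and `letb` becomes a beta redex. -/
inductive Skel : Type
  | cst : Skel
  | var : ℕ → Skel
  | lam : Skel → Skel
  | app : Skel → Skel → Skel
  | ti : (Label → Skel) → Skel

namespace Skel

def ren (ξ : ℕ → ℕ) : Skel → Skel
  | cst => cst
  | var i => var (ξ i)
  | lam t => lam (t.ren (Lhc.up ξ))
  | app t u => app (t.ren ξ) (u.ren ξ)
  | ti f => ti fun ψ => (f ψ).ren ξ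

/-- Weakening of a substitution. -/
def wk (σ : ℕ → Skel) (i : ℕ) : Skel := (σ i).ren Nat.succ

/-- Extension of a substitution by a value for the variable `0`. -/
def scons (t : Skel) (σ : ℕ → Skel) : ℕ → Skel
  | 0 => t
  | n + 1 => σ n

/-- Extension of a substitution under a binder. -/
def up (σ : ℕ → Skel) : ℕ → Skel := scons (var 0) (wk σ)

def subst (σ : ℕ → Skel) : Skel → Skel
  | cst => cst
  | var i => σ i
  | lam t => lam (t.subst (up σ))
  | app t u => app (t.subst σ) (u.subst σ)
  | ti f => ti fun ψ => (f ψ).subst σ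

/-- Substitution for the variable `0`, whose binder is removed. -/
def inst (t u : Skel) : Skel := t.subst (scons u var)

theorem ren_ren (t : Skel) : ∀ ξ ξ' : ℕ → ℕ, (t.ren ξ).ren ξ' = t.ren (ξ' ∘ ξ) := by
  induction t with
  | cst => intros; rfl
  | var i => intros; rfl
  | lam t ih =>
    intro ξ ξ'
    have h : Lhc.up ξ' ∘ Lhc.up ξ = Lhc.up (ξ' ∘ ξ) := by
      funext i; cases i <;> rfl
    simp only [ren, ih, h]
  | app t u iht ihu => intro ξ ξ'; simp only [ren, iht, ihu]
  | ti f ih => intro ξ ξ'; simp only [ren, ih]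

theorem subst_ren (t : Skel) : ∀ (ξ : ℕ → ℕ) (σ : ℕ → Skel),
    (t.ren ξ).subst σ = t.subst (σ ∘ ξ) := by
  induction t with
  | cst => intros; rfl
  | var i => intros; rfl
  | lam t ih =>
    intro ξ σ
    have h : up σ ∘ Lhc.up ξ = up (σ ∘ ξ) := by
      funext i; cases i <;> rfl
    simp only [ren, subst, ih, h]
  | app t u iht ihu => intro ξ σ; simp only [ren, subst, iht, ihu]
  | ti f ih => intro ξ σ; simp only [ren, subst, ih]

theorem ren_wk (σ : ℕ → Skel) (ξ : ℕ → ℕ) :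
    (fun i => (wk σ i).ren (Lhc.up ξ)) = wk fun i => (σ i).ren ξ := by
  funext i; simp only [wk, ren_ren]; rfl

theorem ren_up (σ : ℕ → Skel) (ξ : ℕ → ℕ) :
    (fun i => (up σ i).ren (Lhc.up ξ)) = up fun i => (σ i).ren ξ := by
  funext i
  cases i with
  | zero => rfl
  | succ n => exact congrFun (ren_wk σ ξ) n

theorem ren_subst (t : Skel) : ∀ (σ : ℕ → Skel) (ξ : ℕ → ℕ),
    (t.subst σ).ren ξ = t.subst fun i => (σ i).ren ξ := by
  induction t with
  | cst => intros; rfl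
  | var i => intros; rfl
  | lam t ih => intro σ ξ; simp only [ren, subst, ih, ren_up]
  | app t u iht ihu => intro σ ξ; simp only [ren, subst, iht, ihu]
  | ti f ih => intro σ ξ; simp only [ren, subst, ih]

theorem subst_wk (σ τ : ℕ → Skel) :
    (fun i => (wk σ i).subst (up τ)) = wk fun i => (σ i).subst τ := by
  funext i; simp only [wk, subst_ren, ren_subst]; rfl

theorem subst_up (σ τ : ℕ → Skel) :
    (fun i => (up σ i).subst (up τ)) = up fun i => (σ i).subst τ := by
  funext i
  cases i with
  | zero => rfl
  | succ n => exact congrFun (subst_wk σ τ) n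

theorem subst_subst (t : Skel) : ∀ σ τ : ℕ → Skel,
    (t.subst σ).subst τ = t.subst fun i => (σ i).subst τ := by
  induction t with
  | cst => intros; rfl
  | var i => intros; rfl
  | lam t ih => intro σ τ; simp only [subst, ih, subst_up]
  | app t u iht ihu => intro σ τ; simp only [subst, iht, ihu]
  | ti f ih => intro σ τ; simp only [subst, ih]

theorem up_var : up var = var := by
  funext i; cases i <;> rfl

theorem subst_var (t : Skel) : t.subst var = t := by
  induction t with
  | cst => rfl
  | var i => rfl
  | lam t ih => simp only [subst, up_var, ih]
  | app t u iht ihu => simp only [subst, iht, ihu]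
  | ti f ih => simp only [subst, ih]

theorem wk_subst_scons (σ : ℕ → Skel) (u : Skel) :
    (fun i => (wk σ i).subst (scons u var)) = σ := by
  funext i; simp only [wk, subst_ren]; exact subst_var _

theorem up_subst_scons (σ : ℕ → Skel) (u : Skel) :
    (fun i => (up σ i).subst (scons u var)) = scons u σ := by
  funext i
  cases i with
  | zero => rfl
  | succ n => exact congrFun (wk_subst_scons σ u) n

theorem inst_subst (t u : Skel) (σ : ℕ → Skel) :
    (t.inst u).subst σ = (t.subst (up σ)).inst (u.subst σ) := by
  simp only [inst, subst_subst, up_subst_scons]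
  congr 1
  funext i; cases i <;> rfl

end Skel

-- Nondeterministic reduction of skeletons.

/-- The labels whose branches take no argument. -/
def Label.IsNullary (ψ : Label) : Prop :=
  ψ ∈ [Label.refl, .beta, .betaBox, .tinsp, .otrNil, .dflt]

/-- The labels whose branches take two arguments. -/
def Label.IsBinary (ψ : Label) : Prop := ψ ∈ [Label.trans, .app, .letb, .otrCons]

namespace Skel

/-- The possible results of inspecting some trail with branches `f`. -/
inductive Inspection (f : Label → Skel) : Skel → Prop
  | nullary {ψ : Label} : ψ.IsNullary → Inspection f (f ψ)
  | unary {t : Skel} : Inspection f t → Inspection f (app (f .lam) t)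
  | binary {ψ : Label} {t u : Skel} : ψ.IsBinary → Inspection f t → Inspection f u →
      Inspection f (app (app (f ψ) t) u)

theorem Inspection.subst {f : Label → Skel} {t : Skel} (h : Inspection f t) (σ : ℕ → Skel) :
    Inspection (fun ψ => (f ψ).subst σ) (t.subst σ) := by
  induction h with
  | nullary hψ => exact .nullary (f := fun ψ => (f ψ).subst σ) hψ
  | unary _ ih => exact .unary ih
  | binary hψ _ _ iht ihu => exact .binary (f := fun ψ => (f ψ).subst σ) hψ iht ihu

/-- Reduction at any position. An inspection node reduces to the result of inspecting an arbitrary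
trail. -/
inductive Step : Skel → Skel → Prop
  | beta (t u : Skel) : Step (app (lam t) u) (t.inst u)
  | inspect {f : Label → Skel} {t : Skel} : Inspection f t → Step (ti f) t
  | lam {t t' : Skel} : Step t t' → Step (lam t) (lam t')
  | appL {t t' : Skel} (u : Skel) : Step t t' → Step (app t u) (app t' u)
  | appR (t : Skel) {u u' : Skel} : Step u u' → Step (app t u) (app t u')
  | branch (f : Label → Skel) (ψ : Label) {t : Skel} : Step (f ψ) t →
      Step (ti f) (ti (Function.update f ψ t))

theorem Step.subst {t t' : Skel} (h : Step t t') :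
    ∀ σ : ℕ → Skel, Step (t.subst σ) (t'.subst σ) := by
  induction h with
  | beta t u => intro σ; rw [inst_subst]; exact .beta _ _
  | inspect h => intro σ; exact .inspect (h.subst σ)
  | lam _ ih => intro σ; exact .lam (ih _)
  | appL u _ ih => intro σ; exact .appL _ (ih σ)
  | appR t _ ih => intro σ; exact .appR _ (ih σ)
  | branch f ψ _ ih =>
    intro σ
    have h := Step.branch (fun φ => (f φ).subst σ) ψ (ih σ)
    rwa [← update_map (Skel.subst σ)] at h

/-- Strong normalization of skeletons. -/
def SN (t : Skel) : Prop := Acc (fun t' t => Step t t') t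

/-- Substitution maps steps to steps, so an infinite reduction of `t` would survive in the instance.
This gives strong normalization of the open body of an abstraction from a single reducible instance.
-/
theorem SN.of_subst {t : Skel} {σ : ℕ → Skel} (h : SN (t.subst σ)) : SN t :=
  Subrelation.accessible (r := InvImage (fun t' t => Step t t') (Skel.subst σ))
    (fun h => h.subst σ) (InvImage.accessible _ h)

theorem SN.of_appL {t u : Skel} (h : SN (app t u)) : SN t :=
  Subrelation.accessible (r := InvImage (fun t' t => Step t t') fun t => app t u)
    (fun h => .appL u h) (InvImage.accessible (fun t => app t u) h)

/-- Terms that are not abstractions. -/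
def Neutral : Skel → Prop
  | lam _ => False
  | _ => True

end Skel

-- Reducibility candidates.

section Reducibility
variable {P : Type*}

/-- Reducibility of skeletons. The code in a type `box s A` is irrelevant. -/
def Ty.Reducible : Ty P → Skel → Prop
  | .atom _, t => t.SN
  | .arr A B, t => ∀ u, A.Reducible u → B.Reducible (.app t u)
  | .box _ A, t => A.Reducible t

theorem Ty.reducible_ren (ρ : ℕ → ℕ) : ∀ A : Ty P, (A.ren ρ).Reducible = A.Reducible
  | .atom _ => by funext t; simp only [Ty.ren, Ty.Reducible]
  | .arr A B => by
    funext t; simp only [Ty.ren, Ty.Reducible, reducible_ren ρ A, reducible_ren ρ B]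
  | .box _ A => by funext t; simp only [Ty.ren, Ty.Reducible, reducible_ren ρ A]

/-- Audited variables occur in a type only inside the code of a `box`, which reducibility ignores.
Hence the dependent rule for `letb` can be treated as a simply typed one. -/
theorem Ty.reducible_asubst (τ : ℕ → Code P) :
    ∀ A : Ty P, (A.asubst τ).Reducible = A.Reducible
  | .atom _ => by funext t; simp only [Ty.asubst, Ty.Reducible]
  | .arr A B => by
    funext t; simp only [Ty.asubst, Ty.Reducible, reducible_asubst τ A, reducible_asubst τ B]
  | .box _ A => by funext t; simp only [Ty.asubst, Ty.Reducible, reducible_asubst τ A]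

/-- The closure properties of reducible skeletons. -/
structure Ty.IsCandidate (A : Ty P) : Prop where
  sn : ∀ {t}, A.Reducible t → t.SN
  step : ∀ {t t'}, A.Reducible t → Skel.Step t t' → A.Reducible t'
  expand : ∀ {t}, t.Neutral → (∀ t', Skel.Step t t' → A.Reducible t') → A.Reducible t

/-- The constant is neutral and normal. It serves as a default inhabitant of every type: for free
variables, for simple variables hidden by a box, and for missing branches. -/
theorem Ty.IsCandidate.cst {A : Ty P} (h : A.IsCandidate) : A.Reducible .cst :=
  h.expand trivial fun _ ht => nomatch ht

/-- Girard's three conditions, by induction on the type; at a function type, strong normalization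
comes from applying to `cst`. -/
theorem Ty.isCandidate : ∀ A : Ty P, A.IsCandidate
  | .atom _ =>
    { sn := fun h => by simpa only [Ty.Reducible] using h
      step := fun h hs => by
        simp only [Ty.Reducible] at h ⊢
        exact h.inv hs
      expand := fun _ h => by
        simp only [Ty.Reducible] at h ⊢
        exact ⟨_, h⟩ }
  | .box _ A => by
    have hA := A.isCandidate
    exact
      { sn := fun h => hA.sn (by simpa only [Ty.Reducible] using h)
        step := fun h hs => by
          simp only [Ty.Reducible] at h ⊢
          exact hA.step h hs
        expand := fun hn h => by
          simp only [Ty.Reducible] at h ⊢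
          exact hA.expand hn h }
  | .arr A B => by
    have hA := A.isCandidate
    have hB := B.isCandidate
    refine
      { sn := fun h => ?_
        step := fun h hs => ?_
        expand := fun {t} hn h => ?_ }
    · simp only [Ty.Reducible] at h
      exact (hB.sn (h _ hA.cst)).of_appL
    · simp only [Ty.Reducible] at h ⊢
      exact fun u hu => hB.step (h u hu) (.appL u hs)
    · simp only [Ty.Reducible] at h ⊢
      intro u hu
      -- As `t` is not an abstraction, `app t u` can only step inside `t` or inside `u`; the latter
      -- steps are well founded.
      induction hA.sn hu with
      | intro u _ ih =>
        refine hB.expand trivial fun t' ht' => ?_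
        cases ht' with
        | beta => exact hn.elim
        | appL _ hs => exact h _ hs u hu
        | appR _ hs => exact ih _ hs (hA.step hu hs)

/-- Every reduct of the redex is its contractum or a redex with `t` or `u` reduced, so a nested
induction on strong normalization of `t` and `u` applies, together with closure of candidates under
neutral expansion. -/
theorem Ty.reducible_app_lam {A B : Ty P} {t : Skel}
    (h : ∀ u, A.Reducible u → B.Reducible (t.inst u)) {u : Skel} (hu : A.Reducible u) :
    B.Reducible (.app (.lam t) u) := by
  have hA := A.isCandidate
  have hB := B.isCandidate
  have ht : t.SN := (hB.sn (h _ hA.cst)).of_subst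
  induction ht generalizing u with
  | intro t _ iht =>
    induction hA.sn hu with
    | intro u _ ihu =>
      refine hB.expand trivial fun t' ht' => ?_
      cases ht' with
      | beta => exact h u hu
      | appL _ hs =>
        cases hs with
        -- The hypothesis on instances passes to the reduct of `t` because steps are stable under
        -- substitution.
        | lam hs => exact iht _ hs (fun v hv => hB.step (h v hv) (hs.subst _)) hu
      | appR _ hs => exact ihu _ hs (hA.step hu hs)

/-- `branchTy` gives each label the arity with which `Inspection` uses it, so every result lands in
`B` whatever the trail. -/
theorem Ty.reducible_inspection {B : Ty P} {f : Label → Skel}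
    (hf : ∀ ψ, (branchTy B ψ).Reducible (f ψ)) {t : Skel} (h : Skel.Inspection f t) :
    B.Reducible t := by
  induction h with
  | @nullary ψ hψ =>
    have := hf ψ
    simp only [Label.IsNullary, List.mem_cons, List.not_mem_nil, or_false] at hψ
    rcases hψ with rfl | rfl | rfl | rfl | rfl | rfl <;> exact this
  | unary _ ih =>
    have := hf .lam
    simp only [branchTy, Ty.Reducible] at this
    exact this _ ih
  | @binary ψ _ _ hψ _ _ iht ihu =>
    have := hf ψ
    simp only [Label.IsBinary, List.mem_cons, List.not_mem_nil, or_false] at hψ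
    rcases hψ with rfl | rfl | rfl | rfl <;>
    · simp only [branchTy, Ty.Reducible] at this
      exact this _ iht _ ihu

instance : Fintype Label where
  elems := {.refl, .trans, .beta, .betaBox, .tinsp, .lam, .app, .letb, .otrNil, .otrCons, .dflt}
  complete ψ := by cases ψ <;> decide

/-- Termination of componentwise reduction in finite families. -/
theorem Skel.acc_update {f : Label → Skel} (hf : ∀ ψ, (f ψ).SN) :
    Acc (fun g' g : Label → Skel => ∃ ψ t, Step (g ψ) t ∧ g' = Function.update g ψ t) f := by
  -- `CutExpand` needs an irreflexive relation, which `Step` is not on all skeletons; restricting to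
  -- normalizing sources makes every element accessible.
  let r : Skel → Skel → Prop := fun t' t => Step t t' ∧ SN t
  have hr : ∀ t, SN t → Acc r t := fun t h => Subrelation.accessible (fun h => h.1) h
  have : Std.Irrefl r := ⟨fun t h => by
    induction hr t h.2 with
    | intro t _ ih => exact ih t h h⟩
  -- The family is replaced by the multiset of its values over the finitely many labels;
  -- accessibility of each value gives accessibility of the multiset.
  have h : Acc (Relation.CutExpand r) (Finset.univ.val.map f) :=
    Relation.acc_of_singleton fun t ht => by
      obtain ⟨ψ, _, rfl⟩ := Multiset.mem_map.mp ht
      exact (hr _ (hf ψ)).cutExpand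
  generalize hm : Finset.univ.val.map f = m at h
  induction h generalizing f with
  | intro m _ ih =>
    subst hm
    refine ⟨_, ?_⟩
    rintro _ ⟨ψ, t, hs, rfl⟩
    -- An update at `ψ` trades one occurrence of `f ψ` for the single smaller element `t`.
    refine ih _ ⟨{t}, f ψ, by simpa [r] using ⟨hs, hf ψ⟩, ?_⟩ (fun φ => ?_) rfl
    · have hc : (Finset.univ : Finset Label).val = ψ ::ₘ (Finset.univ.erase ψ).val := by
        rw [← Finset.insert_val_of_notMem (Finset.notMem_erase ψ _),
          Finset.insert_erase (Finset.mem_univ ψ)]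
      have he : (Finset.univ.erase ψ).val.map (Function.update f ψ t) =
          (Finset.univ.erase ψ).val.map f :=
        Multiset.map_congr rfl fun φ hφ =>
          Function.update_of_ne (Finset.ne_of_mem_erase (Finset.mem_val.mp hφ)) _ _
      rw [hc, Multiset.map_cons, Multiset.map_cons, he, Function.update_self,
        ← Multiset.singleton_add, ← Multiset.singleton_add]
      abel
    · by_cases hφ : φ = ψ
      · subst hφ
        rw [Function.update_self]
        exact (hf φ).inv hs
      · rw [Function.update_of_ne hφ]
        exact hf φ

/-- An inspection node is neutral and steps either to an inspection result or by an update of one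
branch; the updates terminate because there are finitely many normalizing branches. -/
theorem Ty.reducible_ti {B : Ty P} {f : Label → Skel}
    (hf : ∀ ψ, (branchTy B ψ).Reducible (f ψ)) : B.Reducible (.ti f) := by
  induction Skel.acc_update fun ψ => (branchTy B ψ).isCandidate.sn (hf ψ) with
  | intro f _ ih =>
    refine B.isCandidate.expand trivial fun t' ht' => ?_
    cases ht' with
    | inspect h => exact Ty.reducible_inspection hf h
    | @branch _ ψ t hs =>
      refine ih _ ⟨ψ, t, hs, rfl⟩ fun φ => ?_
      by_cases hφ : φ = ψ
      · subst hφ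
        rw [Function.update_self]
        exact (branchTy B φ).isCandidate.step (hf φ) hs
      · rw [Function.update_of_ne hφ]
        exact hf φ

end Reducibility

-- Erasure of terms to skeletons, and its behaviour under renaming and substitution.

section Erasure
variable {P : Type*}

mutual
/-- The skeleton of a term, with skeletons `ξ` and `ρ` for the simple and the audited variables. A
box has no simple variables from outside. -/
def Term.skel (ξ ρ : ℕ → Skel) : Term P → Skel
  | .svar i => ξ i
  | .avar i => ρ i
  | .lam _ M => .lam (M.skel (Skel.up ξ) (Skel.wk ρ))
  | .app M N => .app (M.skel ξ ρ) (N.skel ξ ρ)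
  | .bang _ M => M.skel (fun _ => .cst) ρ
  | .letb _ M N => .app (.lam (N.skel (Skel.wk ξ) (Skel.up ρ))) (M.skel ξ ρ)
  | .ti θ => .ti (θ.skel ξ ρ)

/-- The skeletons of branches. Missing branches are filled with the constant. -/
def TermBr.skel (ξ ρ : ℕ → Skel) : TermBr P → Label → Skel
  | .nil => fun _ => .cst
  | .cons ψ M θ => Function.update (θ.skel ξ ρ) ψ (M.skel ξ ρ)
end

mutual
theorem Term.ren_skel (f : ℕ → ℕ) (ξ ρ : ℕ → Skel) : ∀ M : Term P,
    (M.skel ξ ρ).ren f = M.skel (fun i => (ξ i).ren f) (fun i => (ρ i).ren f)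
  | .svar i => rfl
  | .avar i => rfl
  | .lam _ M => by
    simp only [Term.skel, Skel.ren, M.ren_skel, Skel.ren_up, Skel.ren_wk]
  | .app M N => by simp only [Term.skel, Skel.ren, M.ren_skel, N.ren_skel]
  | .bang _ M => by simp only [Term.skel, Skel.ren, M.ren_skel]
  | .letb _ M N => by
    simp only [Term.skel, Skel.ren, M.ren_skel, N.ren_skel, Skel.ren_up, Skel.ren_wk]
  | .ti θ => by simp only [Term.skel, Skel.ren, θ.ren_skel]

theorem TermBr.ren_skel (f : ℕ → ℕ) (ξ ρ : ℕ → Skel) : ∀ θ : TermBr P,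
    (fun ψ => (θ.skel ξ ρ ψ).ren f) = θ.skel (fun i => (ξ i).ren f) (fun i => (ρ i).ren f)
  | .nil => rfl
  | .cons ψ M θ => by
    simp only [TermBr.skel, update_map, ← M.ren_skel, ← θ.ren_skel]
end

mutual
-- Substitution in a skeleton acts on the environments alone. Boxes cause no trouble, since the
-- constants standing for simple variables inside them are fixed by substitution.
theorem Term.subst_skel (σ : ℕ → Skel) (ξ ρ : ℕ → Skel) : ∀ M : Term P,
    (M.skel ξ ρ).subst σ = M.skel (fun i => (ξ i).subst σ) (fun i => (ρ i).subst σ)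
  | .svar i => rfl
  | .avar i => rfl
  | .lam _ M => by
    simp only [Term.skel, Skel.subst, M.subst_skel, Skel.subst_up, Skel.subst_wk]
  | .app M N => by simp only [Term.skel, Skel.subst, M.subst_skel, N.subst_skel]
  | .bang _ M => by simp only [Term.skel, Skel.subst, M.subst_skel]
  | .letb _ M N => by
    simp only [Term.skel, Skel.subst, M.subst_skel, N.subst_skel, Skel.subst_up, Skel.subst_wk]
  | .ti θ => by simp only [Term.skel, Skel.subst, θ.subst_skel]

theorem TermBr.subst_skel (σ : ℕ → Skel) (ξ ρ : ℕ → Skel) : ∀ θ : TermBr P,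
    (fun ψ => (θ.skel ξ ρ ψ).subst σ) =
      θ.skel (fun i => (ξ i).subst σ) (fun i => (ρ i).subst σ)
  | .nil => rfl
  | .cons ψ M θ => by
    simp only [TermBr.skel, update_map, ← M.subst_skel, ← θ.subst_skel]
end

theorem Skel.wk_comp (ξ : ℕ → Skel) (f : ℕ → ℕ) :
    (fun i => wk ξ (f i)) = wk fun i => ξ (f i) := rfl

theorem Skel.up_comp_up (ξ : ℕ → Skel) (f : ℕ → ℕ) :
    (fun i => up ξ (Lhc.up f i)) = up fun i => ξ (f i) := by
  funext i; cases i <;> rfl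

mutual
theorem Term.skel_ren (ξ ρ : ℕ → Skel) (f g : ℕ → ℕ) : ∀ M : Term P,
    (M.ren f g).skel ξ ρ = M.skel (fun i => ξ (f i)) (fun i => ρ (g i))
  | .svar i => rfl
  | .avar i => rfl
  | .lam _ M => by simp only [Term.ren, Term.skel, M.skel_ren, Skel.up_comp_up, Skel.wk_comp]
  | .app M N => by simp only [Term.ren, Term.skel, M.skel_ren, N.skel_ren]
  | .bang _ M => by simp only [Term.ren, Term.skel, M.skel_ren]
  | .letb _ M N => by
    simp only [Term.ren, Term.skel, M.skel_ren, N.skel_ren, Skel.up_comp_up, Skel.wk_comp]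
  | .ti θ => by simp only [Term.ren, Term.skel, θ.skel_ren]

theorem TermBr.skel_ren (ξ ρ : ℕ → Skel) (f g : ℕ → ℕ) : ∀ θ : TermBr P,
    (θ.ren f g).skel ξ ρ = θ.skel (fun i => ξ (f i)) (fun i => ρ (g i))
  | .nil => rfl
  | .cons ψ M θ => by simp only [TermBr.ren, TermBr.skel, M.skel_ren, θ.skel_ren]
end

theorem Term.skel_ren_succ_left (ξ ρ : ℕ → Skel) (M : Term P) :
    (M.ren Nat.succ id).skel (Skel.up ξ) (Skel.wk ρ) = (M.skel ξ ρ).ren Nat.succ := by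
  rw [Term.skel_ren, Term.ren_skel]; rfl

theorem Term.skel_ren_succ_right (ξ ρ : ℕ → Skel) (M : Term P) :
    (M.ren id Nat.succ).skel (Skel.wk ξ) (Skel.up ρ) = (M.skel ξ ρ).ren Nat.succ := by
  rw [Term.skel_ren, Term.ren_skel]; rfl

theorem Term.skel_supS (ξ ρ : ℕ → Skel) (σ : ℕ → Term P) :
    (fun i => (Term.supS σ i).skel (Skel.up ξ) (Skel.wk ρ)) =
      Skel.up fun i => (σ i).skel ξ ρ := by
  funext i
  cases i with
  | zero => rfl
  | succ n => exact Term.skel_ren_succ_left ξ ρ (σ n)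

mutual
-- Substitution of simple variables stops at boxes, and erasure forgets the simple environment
-- there, so no scoping hypothesis is needed.
theorem Term.skel_ssubst (ξ ρ : ℕ → Skel) (σ : ℕ → Term P) : ∀ M : Term P,
    (M.ssubst σ).skel ξ ρ = M.skel (fun i => (σ i).skel ξ ρ) ρ
  | .svar i => rfl
  | .avar i => rfl
  | .lam _ M => by simp only [Term.ssubst, Term.skel, M.skel_ssubst, Term.skel_supS]
  | .app M N => by simp only [Term.ssubst, Term.skel, M.skel_ssubst, N.skel_ssubst]
  | .bang _ M => rfl
  | .letb _ M N => by
    simp only [Term.ssubst, Term.skel, M.skel_ssubst, N.skel_ssubst, Term.skel_ren_succ_right]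
    rfl
  | .ti θ => by simp only [Term.ssubst, Term.skel, θ.skel_ssubst]

theorem TermBr.skel_ssubst (ξ ρ : ℕ → Skel) (σ : ℕ → Term P) : ∀ θ : TermBr P,
    (θ.ssubst σ).skel ξ ρ = θ.skel (fun i => (σ i).skel ξ ρ) ρ
  | .nil => rfl
  | .cons ψ M θ => by simp only [TermBr.ssubst, TermBr.skel, M.skel_ssubst, θ.skel_ssubst]
end

end Erasure

-- Scoping, the invariant that replaces typing in the simulation.

section Scoping
variable {P : Type*}

mutual
/-- The simple variables of a term are below `n`, boxes have no simple variables, and the labels of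
an inspection are distinct. -/
def Term.Scoped : ℕ → Term P → Prop
  | n, .svar i => i < n
  | _, .avar _ => True
  | n, .lam _ M => M.Scoped (n + 1)
  | n, .app M N => M.Scoped n ∧ N.Scoped n
  | _, .bang _ M => M.Scoped 0
  | n, .letb _ M N => M.Scoped n ∧ N.Scoped n
  | n, .ti θ => θ.Scoped n

def TermBr.Scoped : ℕ → TermBr P → Prop
  | _, .nil => True
  | n, .cons ψ M θ => ψ ∉ θ.labels ∧ M.Scoped n ∧ θ.Scoped n
end

mutual
theorem Term.Scoped.mono : ∀ {M : Term P} {n m : ℕ}, M.Scoped n → n ≤ m → M.Scoped m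
  | .svar _, _, _, h, hnm => by simp only [Term.Scoped] at h ⊢; omega
  | .avar _, _, _, _, _ => by simp only [Term.Scoped]
  | .lam _ M, _, _, h, hnm => by
    simp only [Term.Scoped] at h ⊢
    exact Term.Scoped.mono h (Nat.succ_le_succ hnm)
  | .app M N, _, _, h, hnm => by
    simp only [Term.Scoped] at h ⊢
    exact ⟨Term.Scoped.mono h.1 hnm, Term.Scoped.mono h.2 hnm⟩
  | .bang _ M, _, _, h, _ => by simpa only [Term.Scoped] using h
  | .letb _ M N, _, _, h, hnm => by
    simp only [Term.Scoped] at h ⊢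
    exact ⟨Term.Scoped.mono h.1 hnm, Term.Scoped.mono h.2 hnm⟩
  | .ti θ, _, _, h, hnm => by
    simp only [Term.Scoped] at h ⊢
    exact TermBr.Scoped.mono h hnm

theorem TermBr.Scoped.mono : ∀ {θ : TermBr P} {n m : ℕ}, θ.Scoped n → n ≤ m → θ.Scoped m
  | .nil, _, _, _, _ => by simp only [TermBr.Scoped]
  | .cons _ M θ, _, _, h, hnm => by
    simp only [TermBr.Scoped] at h ⊢
    exact ⟨h.1, Term.Scoped.mono h.2.1 hnm, TermBr.Scoped.mono h.2.2 hnm⟩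
end

theorem TermBr.labels_ren (f g : ℕ → ℕ) : ∀ θ : TermBr P, (θ.ren f g).labels = θ.labels
  | .nil => rfl
  | .cons ψ M θ => by simp only [TermBr.ren, TermBr.labels, θ.labels_ren]

theorem TermBr.labels_ssubst (σ : ℕ → Term P) : ∀ θ : TermBr P, (θ.ssubst σ).labels = θ.labels
  | .nil => rfl
  | .cons ψ M θ => by simp only [TermBr.ssubst, TermBr.labels, θ.labels_ssubst]

theorem TermBr.labels_asubst (δ : ℕ → Audit P) : ∀ θ : TermBr P, (θ.asubst δ).labels = θ.labels
  | .nil => rfl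
  | .cons ψ M θ => by simp only [TermBr.asubst, TermBr.labels, θ.labels_asubst]

theorem TermBr.labels_append : ∀ θ θ' : TermBr P,
    (θ.append θ').labels = θ.labels ++ θ'.labels
  | .nil, _ => rfl
  | .cons ψ M θ, θ' => by
    simp only [TermBr.append, TermBr.labels, θ.labels_append, List.cons_append]

theorem up_lt_succ {f : ℕ → ℕ} {n m : ℕ} (h : ∀ i < n, f i < m) : ∀ i < n + 1, up f i < m + 1
  | 0, _ => Nat.succ_pos m
  | i + 1, hi => Nat.succ_lt_succ (h i (Nat.lt_of_succ_lt_succ hi))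

mutual
theorem Term.Scoped.ren : ∀ {M : Term P} {n m : ℕ} {f : ℕ → ℕ} (g : ℕ → ℕ), M.Scoped n →
    (∀ i < n, f i < m) → (M.ren f g).Scoped m
  | .svar _, _, _, _, _, h, hf => by
    simp only [Term.Scoped, Term.ren] at h ⊢
    exact hf _ h
  | .avar _, _, _, _, _, _, _ => by simp only [Term.Scoped, Term.ren]
  | .lam _ M, _, _, _, _, h, hf => by
    simp only [Term.Scoped, Term.ren] at h ⊢
    exact Term.Scoped.ren _ h (up_lt_succ hf)
  | .app M N, _, _, _, _, h, hf => by
    simp only [Term.Scoped, Term.ren] at h ⊢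
    exact ⟨Term.Scoped.ren _ h.1 hf, Term.Scoped.ren _ h.2 hf⟩
  | .bang _ M, _, _, _, _, h, _ => by
    simp only [Term.Scoped, Term.ren] at h ⊢
    exact Term.Scoped.ren _ h fun _ hi => hi
  | .letb _ M N, _, _, _, _, h, hf => by
    simp only [Term.Scoped, Term.ren] at h ⊢
    exact ⟨Term.Scoped.ren _ h.1 hf, Term.Scoped.ren _ h.2 hf⟩
  | .ti θ, _, _, _, _, h, hf => by
    simp only [Term.Scoped, Term.ren] at h ⊢
    exact TermBr.Scoped.ren _ h hf

theorem TermBr.Scoped.ren : ∀ {θ : TermBr P} {n m : ℕ} {f : ℕ → ℕ} (g : ℕ → ℕ), θ.Scoped n →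
    (∀ i < n, f i < m) → (θ.ren f g).Scoped m
  | .nil, _, _, _, _, _, _ => by simp only [TermBr.Scoped, TermBr.ren]
  | .cons _ M θ, _, _, _, _, h, hf => by
    simp only [TermBr.Scoped, TermBr.ren, TermBr.labels_ren] at h ⊢
    exact ⟨h.1, Term.Scoped.ren _ h.2.1 hf, TermBr.Scoped.ren _ h.2.2 hf⟩
end

theorem Term.scoped_supS {σ : ℕ → Term P} {n m : ℕ} (h : ∀ i < n, (σ i).Scoped m) :
    ∀ i < n + 1, (Term.supS σ i).Scoped (m + 1)
  | 0, _ => by simp only [Term.supS, Term.Scoped]; exact Nat.succ_pos m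
  | i + 1, hi => (h i (Nat.lt_of_succ_lt_succ hi)).ren _ fun _ => Nat.succ_lt_succ

mutual
theorem Term.Scoped.ssubst : ∀ {M : Term P} {n m : ℕ} {σ : ℕ → Term P}, M.Scoped n →
    (∀ i < n, (σ i).Scoped m) → (M.ssubst σ).Scoped m
  | .svar _, _, _, _, h, hσ => by
    simp only [Term.Scoped, Term.ssubst] at h ⊢
    exact hσ _ h
  | .avar _, _, _, _, _, _ => by simp only [Term.Scoped, Term.ssubst]
  | .lam _ M, _, _, _, h, hσ => by
    simp only [Term.Scoped, Term.ssubst] at h ⊢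
    exact Term.Scoped.ssubst h (Term.scoped_supS hσ)
  | .app M N, _, _, _, h, hσ => by
    simp only [Term.Scoped, Term.ssubst] at h ⊢
    exact ⟨Term.Scoped.ssubst h.1 hσ, Term.Scoped.ssubst h.2 hσ⟩
  | .bang _ M, _, _, _, h, _ => by simpa only [Term.Scoped, Term.ssubst] using h
  | .letb _ M N, _, _, _, h, hσ => by
    simp only [Term.Scoped, Term.ssubst] at h ⊢
    exact ⟨Term.Scoped.ssubst h.1 hσ,
      Term.Scoped.ssubst h.2 fun i hi => (hσ i hi).ren _ fun _ hj => hj⟩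
  | .ti θ, _, _, _, h, hσ => by
    simp only [Term.Scoped, Term.ssubst] at h ⊢
    exact TermBr.Scoped.ssubst h hσ

theorem TermBr.Scoped.ssubst : ∀ {θ : TermBr P} {n m : ℕ} {σ : ℕ → Term P}, θ.Scoped n →
    (∀ i < n, (σ i).Scoped m) → (θ.ssubst σ).Scoped m
  | .nil, _, _, _, _, _ => by simp only [TermBr.Scoped, TermBr.ssubst]
  | .cons _ M θ, _, _, _, h, hσ => by
    simp only [TermBr.Scoped, TermBr.ssubst, TermBr.labels_ssubst] at h ⊢
    exact ⟨h.1, Term.Scoped.ssubst h.2.1 hσ, TermBr.Scoped.ssubst h.2.2 hσ⟩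
end

/-- An audited substitution whose terms have no simple variables. -/
def Audit.Closed (δ : ℕ → Audit P) : Prop := ∀ i, (δ i).term.Scoped 0

theorem Audit.Closed.ren {δ : ℕ → Audit P} (h : Audit.Closed δ) (f g : ℕ → ℕ) :
    Audit.Closed fun i => (δ i).ren f g :=
  fun i => (h i).ren g fun _ hj => absurd hj (Nat.not_lt_zero _)

theorem Audit.scoped_var (i : ℕ) : (Audit.var i : Audit P).term.Scoped 0 := by
  simp only [Audit.var, Term.Scoped]

theorem Audit.Closed.up {δ : ℕ → Audit P} (h : Audit.Closed δ) : Audit.Closed (Audit.up δ)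
  | 0 => Audit.scoped_var 0
  | i + 1 => h.ren id Nat.succ i

theorem Audit.closed_single {d : Audit P} (h : d.term.Scoped 0) : Audit.Closed (Audit.single d)
  | 0 => h
  | i + 1 => Audit.scoped_var i

mutual
theorem Term.Scoped.asubst : ∀ {M : Term P} {n : ℕ} {δ : ℕ → Audit P}, M.Scoped n →
    Audit.Closed δ → (M.asubst δ).Scoped n
  | .svar _, _, _, h, _ => by simpa only [Term.Scoped, Term.asubst] using h
  | .avar _, _, _, _, hδ => by
    simp only [Term.asubst]
    exact (hδ _).mono (Nat.zero_le _)
  | .lam _ M, _, _, h, hδ => by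
    simp only [Term.Scoped, Term.asubst] at h ⊢
    exact Term.Scoped.asubst h (hδ.ren _ _)
  | .app M N, _, _, h, hδ => by
    simp only [Term.Scoped, Term.asubst] at h ⊢
    exact ⟨Term.Scoped.asubst h.1 hδ, Term.Scoped.asubst h.2 hδ⟩
  | .bang _ M, _, _, h, hδ => by
    simp only [Term.Scoped, Term.asubst] at h ⊢
    exact Term.Scoped.asubst h hδ
  | .letb _ M N, _, _, h, hδ => by
    simp only [Term.Scoped, Term.asubst] at h ⊢
    exact ⟨Term.Scoped.asubst h.1 hδ, Term.Scoped.asubst h.2 hδ.up⟩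
  | .ti θ, _, _, h, hδ => by
    simp only [Term.Scoped, Term.asubst] at h ⊢
    exact TermBr.Scoped.asubst h hδ

theorem TermBr.Scoped.asubst : ∀ {θ : TermBr P} {n : ℕ} {δ : ℕ → Audit P}, θ.Scoped n →
    Audit.Closed δ → (θ.asubst δ).Scoped n
  | .nil, _, _, _, _ => by simp only [TermBr.Scoped, TermBr.asubst]
  | .cons _ M θ, _, _, h, hδ => by
    simp only [TermBr.Scoped, TermBr.asubst, TermBr.labels_asubst] at h ⊢
    exact ⟨h.1, Term.Scoped.asubst h.2.1 hδ, TermBr.Scoped.asubst h.2.2 hδ⟩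
end

theorem Skel.wk_congr {ξ ξ' : ℕ → Skel} {n : ℕ} (h : ∀ i < n, ξ i = ξ' i) :
    ∀ i < n, wk ξ i = wk ξ' i := fun i hi => congrArg _ (h i hi)

theorem Skel.up_congr {ξ ξ' : ℕ → Skel} {n : ℕ} (h : ∀ i < n, ξ i = ξ' i) :
    ∀ i < n + 1, up ξ i = up ξ' i
  | 0, _ => rfl
  | i + 1, hi => wk_congr h i (Nat.lt_of_succ_lt_succ hi)

mutual
-- For `n = 0` this says that the skeleton of a box body does not depend on the simple environment,
-- so the body may be moved out of its box.
theorem Term.Scoped.skel_congr : ∀ {M : Term P} {n : ℕ} {ξ ξ' : ℕ → Skel} (ρ : ℕ → Skel),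
    M.Scoped n → (∀ i < n, ξ i = ξ' i) → M.skel ξ ρ = M.skel ξ' ρ
  | .svar _, _, _, _, _, h, hξ => by
    simp only [Term.Scoped, Term.skel] at h ⊢
    exact hξ _ h
  | .avar _, _, _, _, _, _, _ => rfl
  | .lam _ M, _, _, _, _, h, hξ => by
    simp only [Term.Scoped, Term.skel] at h ⊢
    rw [Term.Scoped.skel_congr _ h (Skel.up_congr hξ)]
  | .app M N, _, _, _, _, h, hξ => by
    simp only [Term.Scoped, Term.skel] at h ⊢
    rw [Term.Scoped.skel_congr _ h.1 hξ, Term.Scoped.skel_congr _ h.2 hξ]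
  | .bang _ M, _, _, _, _, _, _ => rfl
  | .letb _ M N, _, _, _, _, h, hξ => by
    simp only [Term.Scoped, Term.skel] at h ⊢
    rw [Term.Scoped.skel_congr _ h.1 hξ, Term.Scoped.skel_congr _ h.2 (Skel.wk_congr hξ)]
  | .ti θ, _, _, _, _, h, hξ => by
    simp only [Term.Scoped, Term.skel] at h ⊢
    rw [TermBr.Scoped.skel_congr _ h hξ]

theorem TermBr.Scoped.skel_congr : ∀ {θ : TermBr P} {n : ℕ} {ξ ξ' : ℕ → Skel} (ρ : ℕ → Skel),
    θ.Scoped n → (∀ i < n, ξ i = ξ' i) → θ.skel ξ ρ = θ.skel ξ' ρ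
  | .nil, _, _, _, _, _, _ => rfl
  | .cons _ M θ, _, _, _, _, h, hξ => by
    simp only [TermBr.Scoped, TermBr.skel] at h ⊢
    rw [Term.Scoped.skel_congr _ h.2.1 hξ, TermBr.Scoped.skel_congr _ h.2.2 hξ]
end

theorem Audit.Closed.skel_congr {δ : ℕ → Audit P} (h : Audit.Closed δ) (ξ ξ' ρ : ℕ → Skel) :
    (fun i => (δ i).term.skel ξ ρ) = fun i => (δ i).term.skel ξ' ρ :=
  funext fun i => (h i).skel_congr ρ fun _ hj => absurd hj (Nat.not_lt_zero _)

theorem Audit.skel_ren_succ_left (ξ ρ : ℕ → Skel) (δ : ℕ → Audit P) :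
    (fun i => ((δ i).ren Nat.succ id).term.skel (Skel.up ξ) (Skel.wk ρ)) =
      Skel.wk fun i => (δ i).term.skel ξ ρ :=
  funext fun i => Term.skel_ren_succ_left ξ ρ (δ i).term

theorem Audit.skel_up (ξ ρ : ℕ → Skel) (δ : ℕ → Audit P) :
    (fun i => (Audit.up δ i).term.skel (Skel.wk ξ) (Skel.up ρ)) =
      Skel.up fun i => (δ i).term.skel ξ ρ := by
  funext i
  cases i with
  | zero => rfl
  | succ n => exact Term.skel_ren_succ_right ξ ρ (δ n).term

mutual
-- Unlike simple substitution, `asubst` enters boxes, where the simple environment is reset to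
-- `cst`. The substituted terms have the same skeleton inside and outside only because they are
-- closed.
theorem Term.skel_asubst (ξ ρ : ℕ → Skel) {δ : ℕ → Audit P} (hδ : Audit.Closed δ) :
    ∀ M : Term P, (M.asubst δ).skel ξ ρ = M.skel ξ fun i => (δ i).term.skel ξ ρ
  | .svar i => rfl
  | .avar i => rfl
  | .lam _ M => by
    simp only [Term.asubst, Term.skel, M.skel_asubst _ _ (hδ.ren _ _), Audit.skel_ren_succ_left]
  | .app M N => by
    simp only [Term.asubst, Term.skel, M.skel_asubst _ _ hδ, N.skel_asubst _ _ hδ]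
  | .bang _ M => by
    simp only [Term.asubst, Term.skel, M.skel_asubst _ _ hδ, hδ.skel_congr (fun _ => .cst) ξ]
  | .letb _ M N => by
    simp only [Term.asubst, Term.skel, M.skel_asubst _ _ hδ, N.skel_asubst _ _ hδ.up,
      Audit.skel_up]
  | .ti θ => by simp only [Term.asubst, Term.skel, θ.skel_asubst _ _ hδ]

theorem TermBr.skel_asubst (ξ ρ : ℕ → Skel) {δ : ℕ → Audit P} (hδ : Audit.Closed δ) :
    ∀ θ : TermBr P, (θ.asubst δ).skel ξ ρ = θ.skel ξ fun i => (δ i).term.skel ξ ρ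
  | .nil => rfl
  | .cons ψ M θ => by
    simp only [TermBr.asubst, TermBr.skel, M.skel_asubst _ _ hδ, θ.skel_asubst _ _ hδ]
end

mutual
theorem TermTy.scoped : ∀ {Δ Γ : List (Ty P)} {M : Term P} {A : Ty P} {s : Code P},
    TermTy Δ Γ M A s → M.Scoped Γ.length
  | _, _, _, _, _, .svar h => by
    simp only [Term.Scoped]
    exact (List.getElem?_eq_some_iff.mp h).1
  | _, _, _, _, _, .avar _ => by simp only [Term.Scoped]
  | _, _, _, _, _, .lam h => by
    simp only [Term.Scoped]
    exact h.scoped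
  | _, _, _, _, _, .app h h' => by
    simp only [Term.Scoped]
    exact ⟨h.scoped, h'.scoped⟩
  | _, _, _, _, _, .bang h _ => by
    simp only [Term.Scoped]
    exact h.scoped
  | _, _, _, _, _, .letb h h' => by
    simp only [Term.Scoped]
    exact ⟨h.scoped, by simpa [shiftCtx] using h'.scoped⟩
  | _, _, _, _, _, .ti hl _ h => by
    simp only [Term.Scoped]
    -- Branches are typed without simple variables, so they are scoped at `0`.
    exact (h.scoped hl).mono (Nat.zero_le _)

theorem TermBrTy.scoped : ∀ {Δ : List (Ty P)} {ϑ : TermBr P} {B : Ty P} {θ : CodeBr P},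
    TermBrTy Δ ϑ B θ → ϑ.labels.Nodup → ϑ.Scoped 0
  | _, _, _, _, .nil, _ => by simp only [TermBr.Scoped]
  | _, _, _, _, .cons h h', hl => by
    simp only [TermBr.labels, List.nodup_cons] at hl
    simp only [TermBr.Scoped]
    exact ⟨hl.1, h.scoped, h'.scoped hl.2⟩
end

end Scoping

-- The fundamental lemma of reducibility.

section Fundamental
variable {P : Type*}

/-- The skeletons `σ` are reducible at the types of the context. -/
def ReducibleEnv (Γ : List (Ty P)) (σ : ℕ → Skel) : Prop :=
  ∀ (i : ℕ) (A : Ty P), Γ[i]? = some A → A.Reducible (σ i)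

theorem ReducibleEnv.nil (σ : ℕ → Skel) : ReducibleEnv ([] : List (Ty P)) σ :=
  fun _ _ h => by simp at h

theorem ReducibleEnv.cons {Γ : List (Ty P)} {σ : ℕ → Skel} (h : ReducibleEnv Γ σ) {A : Ty P}
    {t : Skel} (ht : A.Reducible t) : ReducibleEnv (A :: Γ) (Skel.scons t σ)
  | 0, B, hB => by
    obtain rfl : A = B := by simpa using hB
    exact ht
  | i + 1, B, hB => h i B (by simpa using hB)

theorem ReducibleEnv.shift {Γ : List (Ty P)} {σ : ℕ → Skel} (h : ReducibleEnv Γ σ) :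
    ReducibleEnv (shiftCtx Γ) σ := by
  intro i A hA
  simp only [shiftCtx, List.getElem?_map, Option.map_eq_some_iff] at hA
  obtain ⟨B, hB, rfl⟩ := hA
  rw [Ty.reducible_ren]
  exact h i B hB

/-- Contracting a skeleton redex amounts to extending the environment; this and its audited analogue
`Term.skel_letb_inst` serve both the fundamental lemma and the simulation. -/
theorem Term.skel_lam_inst (ξ ρ : ℕ → Skel) (M : Term P) (u : Skel) :
    (M.skel (Skel.up ξ) (Skel.wk ρ)).inst u = M.skel (Skel.scons u ξ) ρ := by
  rw [Skel.inst, Term.subst_skel, Skel.up_subst_scons, Skel.wk_subst_scons]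

theorem Term.skel_letb_inst (ξ ρ : ℕ → Skel) (N : Term P) (u : Skel) :
    (N.skel (Skel.wk ξ) (Skel.up ρ)).inst u = N.skel ξ (Skel.scons u ρ) := by
  rw [Skel.inst, Term.subst_skel, Skel.up_subst_scons, Skel.wk_subst_scons]

mutual
/-- The skeleton of a typed term is reducible. -/
theorem TermTy.reducible : ∀ {Δ Γ : List (Ty P)} {M : Term P} {A : Ty P} {s : Code P}
    {ξ ρ : ℕ → Skel}, TermTy Δ Γ M A s → ReducibleEnv Γ ξ → ReducibleEnv Δ ρ →
    A.Reducible (M.skel ξ ρ)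
  | _, _, _, _, _, _, _, .svar h, hξ, _ => hξ _ _ h
  | _, _, _, _, _, _, _, .avar h, _, hρ => hρ _ _ h
  | _, _, _, _, _, _, _, .lam h, hξ, hρ => by
    simp only [Ty.Reducible, Term.skel]
    refine fun u hu => Ty.reducible_app_lam (fun v hv => ?_) hu
    rw [Term.skel_lam_inst]
    exact h.reducible (hξ.cons hv) hρ
  | _, _, _, _, _, _, _, .app h h', hξ, hρ => by
    have := h.reducible hξ hρ
    simp only [Ty.Reducible] at this
    exact this _ (h'.reducible hξ hρ)
  | _, _, _, _, _, _, _, .bang h _, _, hρ => by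
    simp only [Ty.Reducible, Term.skel]
    exact h.reducible (ReducibleEnv.nil _) hρ
  | _, _, _, _, _, _, _, .letb h h', hξ, hρ => by
    have := h.reducible hξ hρ
    simp only [Ty.Reducible] at this
    simp only [Term.skel, Ty.ainst, Ty.reducible_asubst]
    refine Ty.reducible_app_lam (fun v hv => ?_) this
    rw [Term.skel_letb_inst]
    -- `extA` shifts the new type `A` along with the old context, so the environment is extended
    -- before it is shifted.
    exact h'.reducible hξ.shift (hρ.cons hv).shift
  | _, _, _, _, _, _, _, .ti _ _ h, _, hρ => Ty.reducible_ti fun ψ => h.reducible hρ ψ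

theorem TermBrTy.reducible : ∀ {Δ : List (Ty P)} {ϑ : TermBr P} {B : Ty P} {θ : CodeBr P}
    {ξ ρ : ℕ → Skel}, TermBrTy Δ ϑ B θ → ReducibleEnv Δ ρ →
    ∀ ψ, (branchTy B ψ).Reducible (ϑ.skel ξ ρ ψ)
  | _, _, _, _, _, _, .nil, _, ψ => (Ty.isCandidate _).cst
  | _, _, _, _, _, _, .cons (ψ := φ) h h', hρ, ψ => by
    simp only [TermBr.skel]
    by_cases hψ : ψ = φ
    · subst hψ
      rw [Function.update_self]
      exact h.reducible (ReducibleEnv.nil _) hρ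
    · rw [Function.update_of_ne hψ]
      exact h'.reducible hρ ψ
end

end Fundamental

-- Reduction of terms simulated by reduction of skeletons.

section Simulation

section InspectInduction
universe v
variable {P X : Type v} {ap : X → X → X} {f : Label → Option X} {C : X → Prop}

/-- The default label is itself nullary, so falling back to it is covered by `h0`. -/
theorem or_dflt_induction (h0 : ∀ ψ x, ψ.IsNullary → f ψ = some x → C x) {ψ : Label} {x : X}
    (hψ : ψ.IsNullary) (h : (f ψ).or (f .dflt) = some x) : C x := by
  rcases Option.or_eq_some_iff.mp h with h | ⟨_, h⟩
  · exact h0 _ _ hψ h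
  · exact h0 .dflt _ (by simp [Label.IsNullary]) h

theorem branch_unary_induction (h0 : ∀ ψ x, ψ.IsNullary → f ψ = some x → C x)
    (h1 : ∀ s x, f .lam = some s → C x → C (ap s x)) {q : Option X} {x : X}
    (hq : ∀ y, q = some y → C y)
    (h : (match f .lam with
      | none => f .dflt
      | some s => do
        let x ← q
        return ap s x) = some x) : C x := by
  split at h
  · exact h0 .dflt _ (by simp [Label.IsNullary]) h
  · rename_i s hs
    obtain ⟨y, hy, h⟩ := Option.bind_eq_some_iff.mp h
    obtain rfl := Option.some.inj h
    exact h1 _ _ hs (hq _ hy)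

theorem branch_binary_induction (h0 : ∀ ψ x, ψ.IsNullary → f ψ = some x → C x)
    (h2 : ∀ ψ s x y, ψ.IsBinary → f ψ = some s → C x → C y → C (ap (ap s x) y)) {ψ : Label}
    (hψ : ψ.IsBinary) {q q' : Option X} {x : X}
    (hq : ∀ y, q = some y → C y) (hq' : ∀ y, q' = some y → C y)
    (h : (match f ψ with
      | none => f .dflt
      | some s => do
        let x ← q
        let y ← q'
        return ap (ap s x) y) = some x) : C x := by
  split at h
  · exact h0 .dflt _ (by simp [Label.IsNullary]) h
  · rename_i s hs
    obtain ⟨y, hy, h⟩ := Option.bind_eq_some_iff.mp h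
    obtain ⟨z, hz, h⟩ := Option.bind_eq_some_iff.mp h
    obtain rfl := Option.some.inj h
    exact h2 _ _ _ _ hψ hs (hq _ hy) (hq' _ hz)


mutual
/-- Induction on the construction of the result of an inspection. -/
theorem Trail.inspect_induction (h0 : ∀ ψ x, ψ.IsNullary → f ψ = some x → C x)
    (h1 : ∀ s x, f .lam = some s → C x → C (ap s x))
    (h2 : ∀ ψ s x y, ψ.IsBinary → f ψ = some s → C x → C y → C (ap (ap s x) y)) :
    ∀ (q : Trail P) (x : X), q.inspect ap f = some x → C x
  | .refl _, x, h => by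
    simp only [Trail.inspect] at h
    exact or_dflt_induction h0 (by simp [Label.IsNullary]) h
  | .trans q q', x, h => by
    simp only [Trail.inspect] at h
    exact branch_binary_induction h0 h2 (by simp [Label.IsBinary])
      (q.inspect_induction h0 h1 h2) (q'.inspect_induction h0 h1 h2) h
  | .beta _ _ _, x, h => by
    simp only [Trail.inspect] at h
    exact or_dflt_induction h0 (by simp [Label.IsNullary]) h
  | .betaBox _ _ _, x, h => by
    simp only [Trail.inspect] at h
    exact or_dflt_induction h0 (by simp [Label.IsNullary]) h
  | .oti _ _, x, h => by
    simp only [Trail.inspect] at h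
    exact or_dflt_induction h0 (by simp [Label.IsNullary]) h
  | .lam _ q, x, h => by
    simp only [Trail.inspect] at h
    exact branch_unary_induction h0 h1 (q.inspect_induction h0 h1 h2) h
  | .app q q', x, h => by
    simp only [Trail.inspect] at h
    exact branch_binary_induction h0 h2 (by simp [Label.IsBinary])
      (q.inspect_induction h0 h1 h2) (q'.inspect_induction h0 h1 h2) h
  | .letb q _ q', x, h => by
    simp only [Trail.inspect] at h
    exact branch_binary_induction h0 h2 (by simp [Label.IsBinary])
      (q.inspect_induction h0 h1 h2) (q'.inspect_induction h0 h1 h2) h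
  | .otr ζ, x, h => by
    simp only [Trail.inspect] at h
    exact ζ.inspect_induction h0 h1 h2 x h

theorem TrailBr.inspect_induction (h0 : ∀ ψ x, ψ.IsNullary → f ψ = some x → C x)
    (h1 : ∀ s x, f .lam = some s → C x → C (ap s x))
    (h2 : ∀ ψ s x y, ψ.IsBinary → f ψ = some s → C x → C y → C (ap (ap s x) y)) :
    ∀ (ζ : TrailBr P) (x : X), ζ.inspect ap f = some x → C x
  | .nil, x, h => by
    simp only [TrailBr.inspect] at h
    exact or_dflt_induction h0 (by simp [Label.IsNullary]) h
  | .cons _ q ζ, x, h => by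
    simp only [TrailBr.inspect] at h
    exact branch_binary_induction h0 h2 (by simp [Label.IsBinary])
      (q.inspect_induction h0 h1 h2) (ζ.inspect_induction h0 h1 h2) h
end

end InspectInduction

variable {P : Type*}

/-- If a label is repeated, `get` and the nested updates both choose its first occurrence, so
distinctness of labels is not needed here. -/
theorem TermBr.skel_get (ξ ρ : ℕ → Skel) : ∀ {θ : TermBr P} {ψ : Label} {M : Term P},
    θ.get ψ = some M → θ.skel ξ ρ ψ = M.skel ξ ρ
  | .cons φ N θ, ψ, M, h => by
    simp only [TermBr.get] at h
    simp only [TermBr.skel]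
    split_ifs at h with hφ
    · obtain rfl := Option.some.inj h
      rw [← hφ, Function.update_self]
    · rw [Function.update_of_ne (Ne.symm hφ)]
      exact TermBr.skel_get ξ ρ h

theorem TermBr.Scoped.get : ∀ {θ : TermBr P} {n : ℕ} {ψ : Label} {M : Term P}, θ.Scoped n →
    θ.get ψ = some M → M.Scoped n
  | .cons φ N θ, n, ψ, M, hs, h => by
    simp only [TermBr.get] at h
    simp only [TermBr.Scoped] at hs
    split_ifs at h
    · obtain rfl := Option.some.inj h
      exact hs.2.1
    · exact TermBr.Scoped.get hs.2.2 h

theorem TermBr.Scoped.inspectTerm {ϑ : TermBr P} {n : ℕ} (hϑ : ϑ.Scoped n) {q : Trail P}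
    {R : Term P} (h : q.inspectTerm ϑ = some R) : R.Scoped n := by
  refine Trail.inspect_induction (C := fun R => R.Scoped n) (fun ψ M _ hM => hϑ.get hM)
    (fun M N hM hN => ?_) (fun ψ M N N' _ hM hN hN' => ?_) q R h
  · simp only [Term.Scoped]
    exact ⟨hϑ.get hM, hN⟩
  · simp only [Term.Scoped]
    exact ⟨⟨hϑ.get hM, hN⟩, hN'⟩

/-- The trail merely selects one derivation of `Inspection`; nothing else about it has to be
remembered in the skeleton. -/
theorem TermBr.inspection_skel (ξ ρ : ℕ → Skel) {ϑ : TermBr P} {q : Trail P} {R : Term P}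
    (h : q.inspectTerm ϑ = some R) : Skel.Inspection (ϑ.skel ξ ρ) (R.skel ξ ρ) := by
  refine Trail.inspect_induction (C := fun R => Skel.Inspection (ϑ.skel ξ ρ) (R.skel ξ ρ))
    (fun ψ M hψ hM => ?_) (fun M N hM hN => ?_) (fun ψ M N N' hψ hM hN hN' => ?_) q R h
  · rw [← TermBr.skel_get ξ ρ hM]
    exact .nullary hψ
  · simp only [Term.skel]
    rw [← TermBr.skel_get ξ ρ hM]
    exact .unary hN
  · simp only [Term.skel]
    rw [← TermBr.skel_get ξ ρ hM]
    exact .binary hψ hN hN'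

/-- Since `ψ` is not shadowed by an earlier branch, its update commutes past theirs to the outside.
A change of the branch at `ψ` thus becomes an update of a fixed family. -/
theorem TermBr.skel_append_cons (ξ ρ : ℕ → Skel) (ψ : Label) (M : Term P) (θ' : TermBr P) :
    ∀ {θ : TermBr P}, ψ ∉ θ.labels →
      (θ.append (.cons ψ M θ')).skel ξ ρ =
        Function.update ((θ.append θ').skel ξ ρ) ψ (M.skel ξ ρ)
  | .nil, _ => rfl
  | .cons φ N θ, h => by
    simp only [TermBr.labels, List.mem_cons, not_or] at h
    simp only [TermBr.append, TermBr.skel, TermBr.skel_append_cons ξ ρ ψ M θ' h.2]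
    exact Function.update_comm h.1 _ _ _

theorem TermBr.scoped_append_cons {n : ℕ} {ψ : Label} {M : Term P} {θ' : TermBr P} :
    ∀ {θ : TermBr P}, (θ.append (.cons ψ M θ')).Scoped n →
      ψ ∉ θ.labels ∧ M.Scoped n ∧ ∀ N : Term P, N.Scoped n → (θ.append (.cons ψ N θ')).Scoped n
  | .nil, h => by
    simp only [TermBr.append, TermBr.Scoped] at h ⊢
    exact ⟨by simp [TermBr.labels], h.2.1, fun N hN => ⟨h.1, hN, h.2.2⟩⟩
  | .cons φ N θ, h => by
    simp only [TermBr.append, TermBr.Scoped, TermBr.labels_append, TermBr.labels,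
      List.mem_append, List.mem_cons, not_or] at h ⊢
    obtain ⟨h1, h2, h3⟩ := TermBr.scoped_append_cons h.2.2
    exact ⟨⟨Ne.symm h.1.2.1, h1⟩, h2, fun N' hN' => ⟨h.1, h.2.1, h3 N' hN'⟩⟩

/-- Every scoped instance of `M` is turned into a scoped term by replacing `M` with `N`, and this is
a reduction of skeletons. -/
def Simulates (M N : Term P) : Prop :=
  ∀ n, M.Scoped n → N.Scoped n ∧ ∀ ξ ρ, Skel.Step (M.skel ξ ρ) (N.skel ξ ρ)

/-- The hole is not inside a box, so `F` erases to a skeleton context. Quantification over all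
scopes and environments in `Simulates` absorbs the binders of `F`. -/
theorem Simulates.fill {M N : Term P} (h : Simulates M N) :
    ∀ F : FCtx P, Simulates (F.fill M) (F.fill N)
  | .hole => h
  | .lam A F => fun n hM => by
    simp only [FCtx.fill, Term.Scoped, Term.skel] at hM ⊢
    obtain ⟨hs, hr⟩ := h.fill F _ hM
    exact ⟨hs, fun ξ ρ => .lam (hr _ _)⟩
  | .appL F L => fun n hM => by
    simp only [FCtx.fill, Term.Scoped, Term.skel] at hM ⊢
    obtain ⟨hs, hr⟩ := h.fill F _ hM.1
    exact ⟨⟨hs, hM.2⟩, fun ξ ρ => .appL _ (hr _ _)⟩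
  | .appR L F => fun n hM => by
    simp only [FCtx.fill, Term.Scoped, Term.skel] at hM ⊢
    obtain ⟨hs, hr⟩ := h.fill F _ hM.2
    exact ⟨⟨hM.1, hs⟩, fun ξ ρ => .appR _ (hr _ _)⟩
  | .letL A F L => fun n hM => by
    simp only [FCtx.fill, Term.Scoped, Term.skel] at hM ⊢
    obtain ⟨hs, hr⟩ := h.fill F _ hM.1
    exact ⟨⟨hs, hM.2⟩, fun ξ ρ => .appR _ (hr _ _)⟩
  | .letR A L F => fun n hM => by
    simp only [FCtx.fill, Term.Scoped, Term.skel] at hM ⊢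
    obtain ⟨hs, hr⟩ := h.fill F _ hM.2
    -- The body of `letb` erases to the abstraction on the left of the redex, its bound term to the
    -- argument on the right.
    exact ⟨⟨hM.1, hs⟩, fun ξ ρ => .appL _ (.lam (hr _ _))⟩
  | .ti ϑ ψ F ϑ' => fun n hM => by
    simp only [FCtx.fill, Term.Scoped, Term.skel] at hM ⊢
    obtain ⟨hψ, hF, hr⟩ := TermBr.scoped_append_cons hM
    obtain ⟨hs, hstep⟩ := h.fill F _ hF
    refine ⟨hr _ hs, fun ξ ρ => ?_⟩
    rw [TermBr.skel_append_cons ξ ρ ψ _ ϑ' hψ, TermBr.skel_append_cons ξ ρ ψ _ ϑ' hψ]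
    have := Skel.Step.branch (Function.update ((ϑ.append ϑ').skel ξ ρ) ψ ((F.fill M).skel ξ ρ)) ψ
      (t := (F.fill N).skel ξ ρ) (by rw [Function.update_self]; exact hstep ξ ρ)
    rwa [Function.update_idem] at this

theorem simulates_beta (A : Ty P) (M N : Term P) :
    Simulates (.app (.lam A M) N) (M.sinst N) := by
  intro n h
  simp only [Term.Scoped] at h
  refine ⟨h.1.ssubst fun i hi => ?_, fun ξ ρ => ?_⟩
  · cases i with
    | zero => exact h.2
    | succ i =>
      simp only [Term.Scoped]
      exact Nat.lt_of_succ_lt_succ hi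
  · have := Skel.Step.beta (M.skel (Skel.up ξ) (Skel.wk ρ)) (N.skel ξ ρ)
    rw [Term.skel_lam_inst] at this
    simp only [Term.skel, Term.sinst, Term.skel_ssubst]
    convert this using 2
    funext i; cases i <;> rfl

theorem simulates_betaBox (A : Ty P) (q : Trail P) (M N : Term P) :
    Simulates (.letb A (.bang q M) N) (N.asubst (Audit.single ⟨M, q, q.src⟩)) := by
  intro n h
  simp only [Term.Scoped] at h
  have hδ := Audit.closed_single (d := ⟨M, q, q.src⟩) h.1
  refine ⟨h.2.asubst hδ, fun ξ ρ => ?_⟩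
  have := Skel.Step.beta (N.skel (Skel.wk ξ) (Skel.up ρ)) (M.skel (fun _ => .cst) ρ)
  rw [Term.skel_letb_inst] at this
  -- In the redex the body `M` is erased inside its box, with constants for the simple variables; in
  -- the reduct it is erased with `ξ`.
  rw [Term.skel_asubst _ _ hδ, hδ.skel_congr ξ fun _ => .cst]
  simp only [Term.skel]
  convert this using 2
  funext i; cases i <;> rfl

theorem simulates_ti {q : Trail P} {ϑ : TermBr P} {R : Term P} (h : q.inspectTerm ϑ = some R) :
    Simulates (.ti ϑ) R := by
  intro n hn
  simp only [Term.Scoped] at hn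
  exact ⟨hn.inspectTerm h, fun ξ ρ => .inspect (TermBr.inspection_skel ξ ρ h)⟩

/-- Trails are erased, so they may change arbitrarily; this is how the growth of the audit trail
becomes irrelevant. -/
theorem Simulates.bang {M N : Term P} (h : Simulates M N) (q q' : Trail P) :
    Simulates (.bang q M) (.bang q' N) := by
  intro n hM
  simp only [Term.Scoped] at hM ⊢
  exact ⟨(h 0 hM).1, fun ξ ρ => (h 0 hM).2 _ ρ⟩

/-- Reduction happens in the body of a box. -/
theorem Red.exists_simulates {M N : Term P} (h : Red M N) :
    ∃ q M' q' N', M = .bang q M' ∧ N = .bang q' N' ∧ Simulates M' N' := by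
  induction h with
  | beta q F A M N => exact ⟨_, _, _, _, rfl, rfl, (simulates_beta A M N).fill F⟩
  | betaBox q F A q' M N => exact ⟨_, _, _, _, rfl, rfl, (simulates_betaBox A q' M N).fill F⟩
  | ti q F ϑ R h => exact ⟨_, _, _, _, rfl, rfl, (simulates_ti h).fill F⟩
  | bang q F M N _ ih =>
    obtain ⟨q₁, M', q₂, N', rfl, rfl, h⟩ := ih
    exact ⟨_, _, _, _, rfl, rfl, (h.bang q₁ q₂).fill F⟩

/-- Induction on strong normalization of the skeleton. The trail is generalized because each
reduction may change it. -/
theorem Term.Scoped.sn_bang {n : ℕ} {ξ ρ : ℕ → Skel} {M : Term P} (hM : M.Scoped n)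
    (h : (M.skel ξ ρ).SN) (q : Trail P) : SN (.bang q M) := by
  generalize ht : M.skel ξ ρ = t at h
  induction h generalizing M q with
  | intro t _ ih =>
    refine ⟨_, fun N hN => ?_⟩
    obtain ⟨q₁, M', q₂, N', hM', rfl, hs⟩ := hN.exists_simulates
    obtain ⟨rfl, rfl⟩ : q = q₁ ∧ M = M' := by simpa using hM'
    obtain ⟨hN', hstep⟩ := hs n hM
    exact ih _ (ht ▸ hstep ξ ρ) hN' q₂ rfl

theorem TermTy.sn_bang {Δ Γ : List (Ty P)} {M : Term P} {A : Ty P} {s : Code P}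
    (h : TermTy Δ Γ M A s) (q : Trail P) : SN (.bang q M) :=
  h.scoped.sn_bang (ξ := fun _ => .cst) (ρ := fun _ => .cst)
    (A.isCandidate.sn (h.reducible (fun _ B _ => B.isCandidate.cst)
      (fun _ B _ => B.isCandidate.cst))) q

theorem TermTy.sn {Δ Γ : List (Ty P)} {M : Term P} {A : Ty P} {s : Code P}
    (h : TermTy Δ Γ M A s) : SN M := by
  cases h with
  | bang h _ => exact h.sn_bang _
  -- Every reduction starts from a box, so all other terms are normal.
  | _ =>
    refine ⟨_, fun N hN => ?_⟩
    obtain ⟨_, _, _, _, hM, _⟩ := hN.exists_simulates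
    cases hM

end Simulation

end Lhc

theorem mainTheorem1 {P : Type*} (Δ Γ : List (Lhc.Ty P)) (M : Lhc.Term P) (A : Lhc.Ty P)
    (s : Lhc.Code P) (h : Lhc.TermTy Δ Γ M A s) :
    Lhc.SN M ∧ ∀ q : Lhc.Trail P, Lhc.SN (Lhc.Term.bang q M) :=
  ⟨h.sn, h.sn_bang⟩
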